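/- For every integer $n \ge 1$, the following three sets are in bijection: 1. the set of binary generalized de Bruijn words of length $2n$; 2. the set of binary invertible necklaces of length $n$; 3. the set of (unordered) normal bases of $\mathrm{GF}(2^n)$ over $\mathrm{GF}(2)$. Here a *necklace* of length $m$ is a conjugacy class (class under rotation) of words of length $m$. The *Burrows–Wheeler matrix* of a necklace $[w]$ of length $m\ge 1$ is the $m\times m$ matrix whose rows are the $m$ shifts of $w$ (with multiplicity), in ascending lexicographic order; its last column is the *Burrows–Wheeler transform* of $[w]$. A *binary generalized de Bruijn word* of length $2n$ is a necklace of length $2n$ over $\{0,1\}$ whose Burrows–Wheeler transform is a concatenation of words each equal to $01$ or $10$. A binary necklace is *invertible* if the determinant of its Burrows–Wheeler matrix is nonzero modulo $2$. An *unordered normal basis* of $\mathrm{GF}(2^n)$ is a set $\{\gamma,\gamma^2,\gamma^{4},\dots,\gamma^{2^{n-1}}\}$, with $\gamma\in\mathrm{GF}(2^n)$, whose listed $n$ elements form a basis of $\mathrm{GF}(2^n)$ as a vector space over $\mathrm{GF}(2)$. -/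

import Mathlib

namespace CircularWord

/-- Necklaces (conjugacy classes of words) over the alphabet `{0, …, k-1}`:
Mathlib's `Cycle`, the quotient of lists by rotation. -/
abbrev Necklace (k : ℕ) : Type := Cycle (Fin k)

/-- A word over `Fin k` that contains each letter exactly once. -/
def IsAlphabetPermutation {k : ℕ} (w : List (Fin k)) : Prop :=
  ∀ a : Fin k, w.count a = 1

/-- A concatenation of one or more alphabet-permutations. -/
def IsAlphabetPermutationPower {k : ℕ} (w : List (Fin k)) : Prop :=
  ∃ blocks : List (List (Fin k)),
    blocks ≠ [] ∧ (∀ b ∈ blocks, IsAlphabetPermutation b) ∧ w = blocks.flatten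

/-- The rows of the Burrows–Wheeler matrix of a necklace `c`: the `c.length` shifts of a
representative (listed with multiplicity when `c` is periodic), in ascending lexicographic
order. -/
def bwtRows {k : ℕ} (c : Necklace k) : List (List (Fin k)) :=
  c.lists.sort (· ≤ ·)

/-- The Burrows–Wheeler transform: the last column of the Burrows–Wheeler matrix. -/
def bwt {k : ℕ} (c : Necklace k) : List (Fin k) :=
  (bwtRows c).filterMap List.getLast?

/-- Every row of the Burrows–Wheeler matrix has the length of the necklace. -/
theorem length_of_mem_bwtRows {k : ℕ} {c : Necklace k} {r : List (Fin k)}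
    (hr : r ∈ bwtRows c) : r.length = c.length := by
  rw [bwtRows, Multiset.mem_sort, Cycle.mem_lists_iff_coe_eq] at hr
  rw [← hr, Cycle.length_coe]

/-- The Burrows–Wheeler matrix has at least `c.length` rows (exactly so many if `c` is
nonempty). -/
theorem length_le_length_bwtRows {k : ℕ} (c : Necklace k) :
    c.length ≤ (bwtRows c).length := by
  rw [bwtRows, Multiset.length_sort]
  induction c using Quotient.inductionOn' with
  | h l =>
    change l.length ≤ (l.cyclicPermutations).length
    by_cases h : l = []
    · simp [h]
    · rw [List.length_cyclicPermutations_of_ne_nil l h]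

/-- The Burrows–Wheeler matrix of a necklace, as a square matrix of letters. -/
def bwtMatrix {k : ℕ} (c : Necklace k) : Matrix (Fin c.length) (Fin c.length) (Fin k) :=
  Matrix.of fun i j =>
    have hi : i.val < (bwtRows c).length := i.isLt.trans_le (length_le_length_bwtRows c)
    ((bwtRows c)[i.val]'hi)[j.val]'(by
      rw [length_of_mem_bwtRows (List.getElem_mem hi)]; exact j.isLt)

/-- A necklace over `{0, …, p-1}` is invertible if its Burrows–Wheeler matrix is nonsingular
modulo `p`. -/
def IsInvertible {p : ℕ} (c : Necklace p) : Prop :=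
  ((bwtMatrix c).map (fun a : Fin p => (a.val : ZMod p))).det ≠ 0

/-- The generalized de Bruijn words of length `k * n` over `{0, …, k-1}`: the necklaces of that
length whose Burrows–Wheeler transform is an alphabet-permutation power. -/
def generalizedDeBruijnWords (k n : ℕ) : Set (Necklace k) :=
  {c | c.length = k * n ∧ IsAlphabetPermutationPower (bwt c)}

/-- The invertible necklaces of length `n` over `{0, …, p-1}`. -/
def invertibleNecklaces (p n : ℕ) : Set (Necklace p) :=
  {c | c.length = n ∧ IsInvertible c}

/-- `γ` is a normal element of `GF(p ^ n)`: the elements `γ, γ ^ p, …, γ ^ (p ^ (n - 1))` form a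
basis of `GF(p ^ n)` over `GF(p)`. -/
def IsNormalElement (p n : ℕ) [Fact p.Prime] (γ : GaloisField p n) : Prop :=
  LinearIndependent (ZMod p) (fun i : Fin n => γ ^ p ^ i.val) ∧
    Submodule.span (ZMod p) (Set.range fun i : Fin n => γ ^ p ^ i.val) = ⊤

/-- The unordered normal bases of `GF(p ^ n)` over `GF(p)`: the sets
`{γ, γ ^ p, …, γ ^ (p ^ (n - 1))}` for normal elements `γ`. -/
def normalBases (p n : ℕ) [Fact p.Prime] : Set (Set (GaloisField p n)) :=
  {B | ∃ γ : GaloisField p n, IsNormalElement p n γ ∧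
    B = Set.range fun i : Fin n => γ ^ p ^ i.val}

end CircularWord

/-! All three sets are counted: `n` times the size of each is the number of functions `w` on `ZMod
n` with values in `ZMod 2` and invertible circulant matrix. No explicit bijection is produced.

For necklaces and normal bases this number arises directly. The shifts act freely on such `w`, and
the orbits are the invertible necklaces (`card_invertibleNecklaces`) and, in coordinates with
respect to a fixed normal basis, where Frobenius is a shift, the normal bases (`card_normalBases`).

For de Bruijn words both sides are compared with `det (2 - T)`, where `T` is the doubling matrix.
Inverting the Burrows–Wheeler transform identifies the words with the choices `s` for which
`blockPerm s` is a single cycle, and a sum of determinants counts these (`card_blockPerm_cycle`).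
The invertible circulants are counted for odd `n` by Fourier transform over a finite field, and in
general by halving `n` (`card_det_circulant_ne_zero`). -/

/-! ### Rank-one perturbations and determinants that detect a full cycle -/

open Matrix in
theorem Matrix.det_one_add_vecMulVec {N R : Type*} [Fintype N] [DecidableEq N] [CommRing R]
    (u v : N → R) : (1 + vecMulVec u v).det = 1 + v ⬝ᵥ u := by
  rw [vecMulVec_eq Unit, det_one_add_replicateCol_mul_replicateRow]

-- As `A` kills the all-ones vector, replacing `v` by a coordinate vector amounts to splitting off a
-- factor `1 + 1 (v - e_c)ᵀ`, of determinant `∑ v`.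
open Matrix in
theorem Matrix.det_add_vecMulVec_of_mulVec_one {N R : Type*} [Fintype N] [DecidableEq N]
    [CommRing R] (A : Matrix N N R) (h : A *ᵥ 1 = 0) (u v : N → R) (c : N) :
    (A + vecMulVec u v).det = (∑ i, v i) * (A + vecMulVec u (Pi.single c 1)).det := by
  have key : A + vecMulVec u v =
      (A + vecMulVec u (Pi.single c 1)) * (1 + vecMulVec 1 (v - Pi.single c 1)) := by
    rw [mul_add, mul_one, mul_vecMulVec, add_mulVec, h, vecMulVec_mulVec]
    ext i j
    simp [vecMulVec_apply, mul_sub]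
  rw [key, det_mul, det_one_add_vecMulVec]
  simp [dotProduct, mul_comm]

open Matrix in
theorem Matrix.det_add_vecMulVec_of_sum_eq_zero {N R : Type*} [Fintype N] [DecidableEq N]
    [CommRing R] (A : Matrix N N R) (h : A *ᵥ 1 = 0) (h' : 1 ᵥ* A = 0) (u v : N → R) (r c : N) :
    (A + vecMulVec u v).det =
      (∑ i, u i) * (∑ i, v i) *
        (A + vecMulVec (Pi.single r 1) (Pi.single c 1)).det := by
  rw [det_add_vecMulVec_of_mulVec_one A h u v c, ← det_transpose, transpose_add,
    transpose_vecMulVec, det_add_vecMulVec_of_mulVec_one Aᵀ (by rwa [mulVec_transpose]) _ u r,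
    ← det_transpose, transpose_add, transpose_vecMulVec, transpose_transpose]
  ring

open Matrix in
theorem Matrix.sum_det_sumElim {n R : Type*} [Fintype n] [DecidableEq n] [CommRing R]
    {β : Type*} [Fintype β] (a : n → β → n ⊕ n → R) (z : n → n ⊕ n → R) :
    ∑ s : n → β, (of (Sum.elim (fun i => a i (s i)) z)).det =
      (of (Sum.elim (fun i => ∑ b, a i b) z)).det := by
  classical
  simp only [← det_transpose (of (Sum.elim _ z))]
  simp only [det_apply, transpose_apply, of_apply, Fintype.prod_sum_type, Sum.elim_inl,
    Sum.elim_inr, Finset.sum_apply]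
  rw [Finset.sum_comm]
  refine Finset.sum_congr rfl fun τ _ => ?_
  rw [← Finset.smul_sum, ← Finset.sum_mul]
  congr 2
  rw [Finset.prod_univ_sum, Fintype.piFinset_univ]

open Matrix in
theorem Matrix.det_sumElim_add_right {n R : Type*} [Fintype n] [DecidableEq n] [CommRing R]
    (x y : n → n ⊕ n → R) (c : R) :
    (of (Sum.elim x (c • x + y))).det = (of (Sum.elim x y)).det := by
  have : (of (Sum.elim x (c • x + y)) : Matrix (n ⊕ n) (n ⊕ n) R) =
      fromBlocks 1 0 (c • 1) 1 * of (Sum.elim x y) := by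
    ext (i | i) j <;>
      simp [mul_apply, fromBlocks, one_apply, Fintype.sum_sum_type]
  rw [this, det_mul, det_fromBlocks_zero₁₂]
  simp

open Matrix in
theorem Matrix.det_sumElim_add_left {n R : Type*} [Fintype n] [DecidableEq n] [CommRing R]
    (x y : n → n ⊕ n → R) (c : R) :
    (of (Sum.elim (x + c • y) y)).det = (of (Sum.elim x y)).det := by
  have : (of (Sum.elim (x + c • y) y) : Matrix (n ⊕ n) (n ⊕ n) R) =
      fromBlocks 1 (c • 1) 0 1 * of (Sum.elim x y) := by
    ext (i | i) j <;>
      simp [mul_apply, fromBlocks, one_apply, Fintype.sum_sum_type]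
  rw [this, det_mul, det_fromBlocks_zero₂₁]
  simp

open Matrix in
/-- Summing a determinant over all ways of pairing, for each `i`, the two vectors `Y i false`,
`Y i true` with the two rows `X₀ i`, `X₁ i`. -/
theorem Matrix.sum_det_switch {n R : Type*} [Fintype n] [DecidableEq n] [CommRing R]
    (X₀ X₁ : n → n ⊕ n → R) (Y : n → Bool → n ⊕ n → R) :
    ∑ s : n → Bool,
        (of (Sum.elim (fun i => X₀ i - Y i (s i)) (fun i => X₁ i - Y i (!s i)))).det =
      (of (Sum.elim (X₀ - X₁)
        (fun i => X₀ i + X₁ i - (Y i false + Y i true)))).det := by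
  set Z : n → n ⊕ n → R := fun i => X₀ i + X₁ i - (Y i false + Y i true) with hZ
  -- Adding the top row `i` to the bottom row `i` yields `Z i`, which no longer depends on `s`;
  -- multilinearity in the top rows then applies.
  have h1 : ∀ s : n → Bool,
      (of (Sum.elim (fun i => X₀ i - Y i (s i)) (fun i => X₁ i - Y i (!s i)))).det =
        (of (Sum.elim (fun i => X₀ i - Y i (s i)) Z)).det := by
    intro s
    rw [← det_sumElim_add_right _ (fun i => X₁ i - Y i (!s i)) 1]
    congr 3
    funext i
    simp only [hZ, Pi.add_apply, one_smul]
    cases s i <;> simp <;> abel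
  simp only [h1]
  rw [sum_det_sumElim (fun i b => X₀ i - Y i b) Z, ← det_sumElim_add_left (X₀ - X₁) Z 1]
  congr 3
  funext i
  simp only [hZ, Fintype.sum_bool, Pi.add_apply, Pi.sub_apply, one_smul]
  abel

theorem Function.iterate_minimalPeriod_bijective_fin {E : Type*} [Fintype E] {f : E → E} {x : E}
    (h : minimalPeriod f x = Fintype.card E) :
    Bijective fun k : Fin (Fintype.card E) => f^[k] x := by
  rw [Fintype.bijective_iff_injective_and_card]
  refine ⟨fun k l hkl => ?_, by simp⟩
  exact Fin.ext (iterate_injOn_Iio_minimalPeriod (by simp [h]) (by simp [h]) hkl)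

open Function in
theorem Equiv.Perm.minimalPeriod_eq_card {E : Type*} [Fintype E] {σ : Equiv.Perm E} {x : E}
    (h : ∀ y, ∃ k : ℕ, (σ^[k]) x = y) : minimalPeriod σ x = Fintype.card E := by
  have hp : 0 < minimalPeriod σ x :=
    minimalPeriod_pos_of_mem_periodicPts (σ.injective.mem_periodicPts x)
  have hs : Surjective fun k : Fin (minimalPeriod σ x) => σ^[k] x := by
    intro y
    obtain ⟨k, rfl⟩ := h y
    exact ⟨⟨k % minimalPeriod σ x, Nat.mod_lt _ hp⟩, iterate_mod_minimalPeriod_eq⟩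
  have hi : Injective fun k : Fin (minimalPeriod σ x) => σ^[k] x := fun k l hkl =>
    Fin.ext (iterate_injOn_Iio_minimalPeriod k.isLt l.isLt hkl)
  simpa using Fintype.card_of_bijective ⟨hi, hs⟩

-- The rank-one term deletes the one arc returning to `x`. Listed along the orbit of `x`, the matrix
-- becomes upper unitriangular.
open Matrix Function in
theorem Matrix.det_one_sub_perm_add_single {E R : Type*} [Fintype E] [DecidableEq E] [CommRing R]
    (σ : Equiv.Perm E) (x : E) (h : minimalPeriod σ x = Fintype.card E) :
    ((1 - of fun i j => if σ i = j then (1 : R) else 0) +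
      vecMulVec (Pi.single (σ.symm x) 1) (Pi.single x 1)).det = 1 := by
  let e : Fin (Fintype.card E) ≃ E :=
    Equiv.ofBijective _ (iterate_minimalPeriod_bijective_fin h)
  have he : ∀ k, e k = σ^[k] x := fun k => rfl
  have hval : ((1 - of fun i j => if σ i = j then (1 : R) else 0) +
      vecMulVec (Pi.single (σ.symm x) 1) (Pi.single x 1)) =
      of fun i j => (if i = j then (1 : R) else 0) - if σ i = j ∧ j ≠ x then 1 else 0 := by
    ext i j
    simp only [add_apply, sub_apply, one_apply, of_apply, vecMulVec_apply, Pi.single_apply,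
      Equiv.eq_symm_apply]
    by_cases h1 : σ i = x <;> by_cases h2 : j = x <;> by_cases h3 : σ i = j <;> simp_all
  rw [hval, ← det_submatrix_equiv_self e]
  have step : ∀ k l : Fin (Fintype.card E), σ (e k) = e l → e l ≠ x → (k : ℕ) + 1 = l := by
    intro k l hkl hl
    rw [he, he, ← iterate_succ_apply' σ] at hkl
    rcases (Nat.succ_le_of_lt k.isLt).lt_or_eq with hk | hk
    · exact iterate_injOn_Iio_minimalPeriod (by rw [h]; exact hk) (by simp [h]) hkl
    · have hx : σ^[(k : ℕ).succ] x = x := by rw [hk, ← h, iterate_minimalPeriod]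
      exact absurd (hkl.symm.trans hx) hl
  rw [det_of_isUpperTriangular]
  · refine Finset.prod_eq_one fun k _ => ?_
    simp only [submatrix_apply, of_apply, if_true]
    rw [if_neg, sub_zero]
    rintro ⟨h1, h2⟩
    have := step k k h1 h2
    omega
  · intro k l hkl
    have hkl : l < k := hkl
    simp only [submatrix_apply, of_apply]
    rw [if_neg, if_neg, sub_zero]
    · rintro ⟨h1, h2⟩
      have := step k l h1 h2
      omega
    · intro h1
      exact hkl.ne' (e.injective h1)

-- With at least two cycles, the kernel of `1 - P` contains the indicators of the cycle of `x` and
-- of its complement; some nonzero combination of them is orthogonal to `v`.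
open Matrix Function in
theorem Matrix.det_one_sub_perm_add_vecMulVec_of_ne {E R : Type*} [Fintype E] [DecidableEq E]
    [Field R] (σ : Equiv.Perm E) (x : E) (h : minimalPeriod σ x ≠ Fintype.card E)
    (u v : E → R) :
    ((1 - of fun i j => if σ i = j then (1 : R) else 0) + vecMulVec u v).det = 0 := by
  classical
  obtain ⟨y, hy⟩ : ∃ y, ¬ σ.SameCycle x y := by
    by_contra! hcon
    refine h (Equiv.Perm.minimalPeriod_eq_card fun y => ?_)
    obtain ⟨k, hk⟩ := (hcon y).exists_nat_pow_eq
    exact ⟨k, by rw [Equiv.Perm.iterate_eq_pow, hk]⟩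
  have hinv : ∀ z : E → R, (∀ i, z (σ i) = z i) →
      (1 - of fun i j => if σ i = j then (1 : R) else 0) *ᵥ z = 0 := by
    intro z hz
    ext i
    rw [sub_mulVec, one_mulVec]
    simp [mulVec, dotProduct, hz]
  let z₁ : E → R := fun i => if σ.SameCycle x i then 1 else 0
  let z₂ : E → R := fun i => if σ.SameCycle x i then 0 else 1
  have h₁ : ∀ i, z₁ (σ i) = z₁ i := fun i => by simp [z₁]
  have h₂ : ∀ i, z₂ (σ i) = z₂ i := fun i => by simp [z₂]
  have hx1 : z₁ x = 1 := if_pos (Equiv.Perm.SameCycle.refl σ x)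
  have hy1 : z₁ y = 0 := by simp [z₁, hy]
  have hy2 : z₂ y = 1 := by simp [z₂, hy]
  rw [← exists_mulVec_eq_zero_iff]
  by_cases hv : v ⬝ᵥ z₁ = 0
  · refine ⟨z₁, fun h0 => by simp [h0] at hx1, ?_⟩
    rw [add_mulVec, hinv _ h₁, vecMulVec_mulVec, hv]
    simp
  · refine ⟨(v ⬝ᵥ z₂) • z₁ - (v ⬝ᵥ z₁) • z₂, fun h0 => ?_, ?_⟩
    · have := congrFun h0 y
      simp [hy1, hy2] at this
      exact hv this
    · rw [add_mulVec, hinv _ fun i => by simp [h₁, h₂], vecMulVec_mulVec]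
      simp [dotProduct_sub, dotProduct_smul, mul_comm]

open Matrix Function in
/-- A rank one perturbation of `1 - P`, where `P` is a permutation matrix, detects whether the
permutation is a single cycle. -/
theorem Matrix.det_one_sub_perm_add_vecMulVec {E R : Type*} [Fintype E] [DecidableEq E]
    [Field R] (σ : Equiv.Perm E) (x : E) (u v : E → R) :
    ((1 - of fun i j => if σ i = j then (1 : R) else 0) + vecMulVec u v).det =
      if minimalPeriod σ x = Fintype.card E then (∑ i, u i) * ∑ i, v i else 0 := by
  split_ifs with h
  · rw [det_add_vecMulVec_of_sum_eq_zero _ ?_ ?_ u v (σ.symm x) x,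
      det_one_sub_perm_add_single σ x h, mul_one]
    · ext i
      rw [sub_mulVec, one_mulVec]
      simp [mulVec, dotProduct]
    · ext i
      rw [vecMul_sub, vecMul_one]
      simp [vecMul, dotProduct, ← Equiv.eq_symm_apply]
  · exact det_one_sub_perm_add_vecMulVec_of_ne σ x h u v

/-! ### Edges of the generalized de Bruijn graph and the permutation given by a choice of blocks -/

namespace CircularWord

/-- The letter at position `r` of the word in `{01, 10}ⁿ` encoded by `s`: the `i`-th block is `01`
if `s i` is false and `10` otherwise. -/
def blockLetter {n : ℕ} (s : ZMod n → Bool) (r : Fin (2 * n)) : Fin 2 :=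
  if (s ((r : ℕ) / 2 : ℕ)).toNat = (r : ℕ) % 2 then 0 else 1

/-- The letter at position `e` of the word `0ⁿ1ⁿ`. -/
def sortedLetter {n : ℕ} (e : Fin (2 * n)) : Fin 2 := if (e : ℕ) < n then 0 else 1

theorem sortedLetter_eq_zero {n : ℕ} {e : Fin (2 * n)} : sortedLetter e = 0 ↔ (e : ℕ) < n := by
  unfold sortedLetter; split_ifs <;> simp_all

theorem sortedLetter_eq_one {n : ℕ} {e : Fin (2 * n)} : sortedLetter e = 1 ↔ n ≤ (e : ℕ) := by
  unfold sortedLetter; split_ifs <;> simp_all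

/-- The inverse of the standard permutation of the word in `{01, 10}ⁿ` encoded by `s`. -/
def blockPerm {n : ℕ} (s : ZMod n → Bool) : Equiv.Perm (Fin (2 * n)) where
  toFun e :=
    if h : (e : ℕ) < n then ⟨2 * e + (s (e : ℕ)).toNat, by
      have := Bool.toNat_lt (s (e : ℕ)); omega⟩
    else ⟨2 * (e - n) + (!s (e : ℕ)).toNat, by
      have := Bool.toNat_lt (!s (e : ℕ)); have := e.isLt; omega⟩
  invFun r :=
    if blockLetter s r = 0 then ⟨r / 2, by have := r.isLt; omega⟩
    else ⟨n + r / 2, by have := r.isLt; omega⟩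
  left_inv e := by
    have he := e.isLt
    by_cases h : (e : ℕ) < n
    · simp only [h, dif_pos, blockLetter]
      have h1 : (2 * (e : ℕ) + (s (e : ℕ)).toNat) / 2 = e := by
        have := Bool.toNat_lt (s (e : ℕ)); omega
      have h2 : (2 * (e : ℕ) + (s (e : ℕ)).toNat) % 2 = (s (e : ℕ)).toNat := by
        have := Bool.toNat_lt (s (e : ℕ)); omega
      simp [h1, h2]
    · simp only [h, dif_neg, blockLetter, not_false_eq_true]
      have h1 : (2 * ((e : ℕ) - n) + (!s (e : ℕ)).toNat) / 2 = e - n := by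
        have := Bool.toNat_lt (!s (e : ℕ)); omega
      have h2 : (2 * ((e : ℕ) - n) + (!s (e : ℕ)).toNat) % 2 = (!s (e : ℕ)).toNat := by
        have := Bool.toNat_lt (!s (e : ℕ)); omega
      -- The edges `e` and `e - n` have the same target modulo `n`, so they consult the same value
      -- of `s` and receive the two different edges leaving that vertex.
      have h3 : (((e : ℕ) - n : ℕ) : ZMod n) = ((e : ℕ) : ZMod n) := by
        rw [Nat.cast_sub (not_lt.1 h)]; simp
      simp only [h1, h2, h3]
      rw [if_neg]
      · ext; simp; omega
      · cases s (e : ℕ) <;> simp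
  right_inv r := by
    have hr := r.isLt
    have h2 : (r : ℕ) % 2 < 2 := Nat.mod_lt _ (by norm_num)
    unfold blockLetter
    by_cases h : (s ((r : ℕ) / 2 : ℕ)).toNat = (r : ℕ) % 2
    · have h1 : (r : ℕ) / 2 < n := by omega
      simp only [h, if_true, h1, dif_pos]
      ext; simp; omega
    · have h3 : ((n + (r : ℕ) / 2 : ℕ) : ZMod n) = ((r : ℕ) / 2 : ℕ) := by push_cast; simp
      have h4 : (!s ((r : ℕ) / 2 : ℕ)).toNat = (r : ℕ) % 2 := by
        revert h
        cases s ((r : ℕ) / 2 : ℕ) <;> simp <;> omega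
      simp only [h, if_false, one_ne_zero, h3]
      rw [dif_neg (by omega)]
      ext; simp [h4]; omega

theorem blockPerm_of_lt {n : ℕ} (s : ZMod n → Bool) {e : Fin (2 * n)} (h : (e : ℕ) < n) :
    (blockPerm s e : ℕ) = 2 * e + (s (e : ℕ)).toNat := by
  simp [blockPerm, h]

theorem blockPerm_of_le {n : ℕ} (s : ZMod n → Bool) {e : Fin (2 * n)} (h : n ≤ (e : ℕ)) :
    (blockPerm s e : ℕ) = 2 * (e - n) + (!s (e : ℕ)).toNat := by
  simp [blockPerm, not_lt.2 h]

theorem blockPerm_symm_val {n : ℕ} (s : ZMod n → Bool) (r : Fin (2 * n)) :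
    ((blockPerm s).symm r : ℕ) = n * (blockLetter s r : ℕ) + r / 2 := by
  change ((if blockLetter s r = 0 then _ else _ : Fin (2 * n)) : ℕ) = _
  unfold blockLetter
  split_ifs <;> simp_all

/-- The edges of the generalized de Bruijn graph, indexed by target vertex. -/
def edgeEquiv (n : ℕ) [NeZero n] : ZMod n ⊕ ZMod n ≃ Fin (2 * n) where
  toFun := Sum.elim (fun i => ⟨i.val, by have := i.val_lt; omega⟩)
    (fun i => ⟨n + i.val, by have := i.val_lt; omega⟩)
  invFun e := if (e : ℕ) < n then .inl (e : ℕ) else .inr (e : ℕ)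
  left_inv := by
    rintro (i | i)
    · simp [i.val_lt]
    · simp
  right_inv e := by
    have he := e.isLt
    by_cases h : (e : ℕ) < n
    · ext; simp [h, Nat.mod_eq_of_lt h]
    · have : ((e : ℕ) : ZMod n) = ((e - n : ℕ) : ZMod n) := by
        rw [Nat.cast_sub (not_lt.1 h)]; simp
      ext
      simp only [h, if_false, Sum.elim_inr, this]
      rw [ZMod.val_cast_of_lt (by omega)]
      omega

theorem edgeEquiv_inl (n : ℕ) [NeZero n] (i : ZMod n) :
    (edgeEquiv n (.inl i) : ℕ) = i.val := rfl

theorem edgeEquiv_inr (n : ℕ) [NeZero n] (i : ZMod n) :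
    (edgeEquiv n (.inr i) : ℕ) = n + i.val := rfl

theorem natCast_edgeEquiv_inl (n : ℕ) [NeZero n] (i : ZMod n) :
    ((edgeEquiv n (.inl i) : ℕ) : ZMod n) = i := by
  simp [edgeEquiv_inl]

theorem natCast_edgeEquiv_inr (n : ℕ) [NeZero n] (i : ZMod n) :
    ((edgeEquiv n (.inr i) : ℕ) : ZMod n) = i := by
  simp [edgeEquiv_inr]

/-- The edge whose source is `i` and whose position among the edges with this source is `b`. -/
def outEdge {n : ℕ} [NeZero n] (i : ZMod n) (b : Bool) : Fin (2 * n) :=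
  ⟨2 * i.val + b.toNat, by have := i.val_lt; have := Bool.toNat_lt b; omega⟩

theorem blockPerm_edgeEquiv_inl {n : ℕ} [NeZero n] (s : ZMod n → Bool) (i : ZMod n) :
    blockPerm s (edgeEquiv n (.inl i)) = outEdge i (s i) := by
  ext
  rw [blockPerm_of_lt s (by rw [edgeEquiv_inl]; exact i.val_lt), natCast_edgeEquiv_inl,
    edgeEquiv_inl, outEdge]

theorem blockPerm_edgeEquiv_inr {n : ℕ} [NeZero n] (s : ZMod n → Bool) (i : ZMod n) :
    blockPerm s (edgeEquiv n (.inr i)) = outEdge i (!s i) := by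
  ext
  rw [blockPerm_of_le s (by rw [edgeEquiv_inr]; omega), natCast_edgeEquiv_inr,
    edgeEquiv_inr, outEdge]
  simp

theorem natCast_outEdge {n : ℕ} [NeZero n] (i : ZMod n) (b : Bool) :
    ((outEdge i b : ℕ) : ZMod n) = 2 * i + (b.toNat : ℕ) := by
  simp [outEdge]

theorem edgeEquiv_symm_eq {n : ℕ} [NeZero n] (e : Fin (2 * n)) :
    (edgeEquiv n).symm e = if (e : ℕ) < n then .inl ((e : ℕ) : ZMod n) else .inr ((e : ℕ) : ZMod n) :=
  rfl

end CircularWord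

/-! ### Counting the choices that give a single cycle -/

namespace CircularWord

open Matrix

/-- The matrix of `f ↦ (i ↦ f (2 * i))` on functions on `ZMod n`. -/
def doublingMatrix (n : ℕ) (R : Type*) [Zero R] [One R] : Matrix (ZMod n) (ZMod n) R :=
  of fun i j => if 2 * i = j then 1 else 0

/-- The adjacency matrix of the binary generalized de Bruijn graph on `ZMod n`. -/
def deBruijnMatrix (n : ℕ) (R : Type*) [AddMonoidWithOne R] : Matrix (ZMod n) (ZMod n) R :=
  of fun i j => (if 2 * i = j then 1 else 0) + if 2 * i + 1 = j then 1 else 0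

/-- Every vertex has in-degree two: the edges are permuted by `blockPerm`, and each residue modulo
`n` has two representatives below `2 * n`. Doubling need not be injective. -/
theorem sum_deBruijnMatrix {n : ℕ} [NeZero n] (R : Type*) [CommRing R] (j : ZMod n) :
    ∑ i, deBruijnMatrix n R i j = 2 := by
  have h : ∀ e : ZMod n ⊕ ZMod n,
      ((blockPerm (fun _ => false) (edgeEquiv n e) : ℕ) : ZMod n) =
        Sum.elim (fun i => 2 * i) (fun i => 2 * i + 1) e := by
    rintro (i | i)
    · rw [blockPerm_edgeEquiv_inl, natCast_outEdge]; simp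
    · rw [blockPerm_edgeEquiv_inr, natCast_outEdge]; simp
  calc ∑ i, deBruijnMatrix n R i j
      = ∑ e : ZMod n ⊕ ZMod n,
        if ((blockPerm (fun _ => false) (edgeEquiv n e) : ℕ) : ZMod n) = j then (1 : R) else 0 := by
        simp only [h, Fintype.sum_sum_type, Sum.elim_inl, Sum.elim_inr, deBruijnMatrix, of_apply,
          Finset.sum_add_distrib]
        congr
    _ = ∑ e : ZMod n ⊕ ZMod n, if ((edgeEquiv n e : ℕ) : ZMod n) = j then (1 : R) else 0 := by
        rw [(edgeEquiv n).sum_comp fun r : Fin (2 * n) =>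
            if ((blockPerm (fun _ => false) r : ℕ) : ZMod n) = j then (1 : R) else 0,
          Equiv.sum_comp (blockPerm fun _ => false) fun r : Fin (2 * n) =>
            if ((r : ℕ) : ZMod n) = j then (1 : R) else 0,
          ← (edgeEquiv n).sum_comp]
    _ = 2 := by
        simp only [Fintype.sum_sum_type, natCast_edgeEquiv_inl, natCast_edgeEquiv_inr]
        simp
        norm_num

/-- The value `s i` swaps the two edges leaving `i`, so `sum_det_switch` applies. A Schur complement
then merges the two edges entering each vertex; the factor 4 comes from merging rows and columns in
pairs. -/
theorem sum_det_one_sub_blockPerm {n : ℕ} [NeZero n] {R : Type*} [CommRing R] (u : ZMod n → R) :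
    ∑ s : ZMod n → Bool,
      ((1 - of fun i j => if blockPerm s i = j then (1 : R) else 0) +
        vecMulVec (fun e : Fin (2 * n) => u (e : ℕ)) 1).det =
      (2 • 1 - deBruijnMatrix n R + vecMulVec (4 • u) 1).det := by
  let X₀ : ZMod n → ZMod n ⊕ ZMod n → R := fun i j => (if .inl i = j then 1 else 0) + u i
  let X₁ : ZMod n → ZMod n ⊕ ZMod n → R := fun i j => (if .inr i = j then 1 else 0) + u i
  let Y : ZMod n → Bool → ZMod n ⊕ ZMod n → R := fun i b j =>
    if outEdge i b = edgeEquiv n j then 1 else 0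
  have h1 : ∀ s : ZMod n → Bool,
      ((1 - of fun i j => if blockPerm s i = j then (1 : R) else 0) +
        vecMulVec (fun e : Fin (2 * n) => u (e : ℕ)) 1).det =
      (of (Sum.elim (fun i => X₀ i - Y i (s i)) (fun i => X₁ i - Y i (!s i)))).det := by
    intro s
    rw [← det_submatrix_equiv_self (edgeEquiv n)]
    congr 1
    ext (i | i) j
    · simp only [submatrix_apply, Matrix.add_apply, Matrix.sub_apply, Matrix.one_apply, of_apply, vecMulVec_apply,
        blockPerm_edgeEquiv_inl, natCast_edgeEquiv_inl, (edgeEquiv n).injective.eq_iff,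
        Sum.elim_inl, Pi.sub_apply, X₀, Y, Pi.one_apply]
      ring
    · simp only [submatrix_apply, Matrix.add_apply, Matrix.sub_apply, Matrix.one_apply, of_apply, vecMulVec_apply,
        blockPerm_edgeEquiv_inr, natCast_edgeEquiv_inr, (edgeEquiv n).injective.eq_iff,
        Sum.elim_inr, Pi.sub_apply, X₁, Y, Pi.one_apply]
      ring
  simp only [h1]
  rw [sum_det_switch X₀ X₁ Y]
  let C : (ZMod n → ZMod n ⊕ ZMod n) → Matrix (ZMod n) (ZMod n) R := fun ι => of fun i j =>
    X₀ i (ι j) + X₁ i (ι j) - (Y i false (ι j) + Y i true (ι j))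
  have h2 : (of (Sum.elim (X₀ - X₁) (fun i => X₀ i + X₁ i - (Y i false + Y i true))) :
      Matrix (ZMod n ⊕ ZMod n) (ZMod n ⊕ ZMod n) R) =
      fromBlocks 1 (-1) (C .inl) (C .inr) := by
    ext (i | i) (j | j) <;> simp [X₀, X₁, C, Matrix.one_apply]
  rw [h2, det_fromBlocks_one₁₁, mul_neg, mul_one, sub_neg_eq_add]
  congr 1
  have hY : ∀ i b j, Y i b (.inl j) + Y i b (.inr j) =
      if 2 * i + (b.toNat : ℕ) = j then (1 : R) else 0 := by
    intro i b j
    simp only [Y, ← (edgeEquiv n).symm_apply_eq, edgeEquiv_symm_eq, natCast_outEdge]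
    split_ifs <;> simp_all
  ext i j
  have hf := hY i false j
  have ht := hY i true j
  simp only [Bool.toNat_false, Bool.toNat_true, Nat.cast_zero, add_zero, Nat.cast_one] at hf ht
  simp only [Matrix.add_apply, Matrix.sub_apply, Matrix.smul_apply, vecMulVec_apply,
    deBruijnMatrix, of_apply, C, ← hf, ← ht, Matrix.one_apply, X₀, X₁, Sum.inl.injEq, Sum.inr.injEq,
    reduceCtorEq, if_false, Pi.smul_apply, Pi.one_apply]
  simp only [nsmul_eq_mul]
  push_cast
  ring

/-- The term `(M b - b) 1ᵀ` vanishes on `D` and corrects `(2 - M) b` to `b`, so the intertwiner `D`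
may be completed by `b bᵀ`. -/
theorem mul_add_vecMulVec_of_intertwine {N R : Type*} [Fintype N] [DecidableEq N] [CommRing R]
    {M Ψ D : Matrix N N R} {b : N → R} (hD : 1 ᵥ* D = 0) (hMD : M * D = D * Ψ)
    (hb : b ᵥ* (2 • 1 - Ψ) = b) (h1b : 1 ⬝ᵥ b = 1) :
    (2 • 1 - M + vecMulVec (M *ᵥ b - b) 1) * (D + vecMulVec b b) =
      (D + vecMulVec b b) * (2 • 1 - Ψ) := by
  rw [mul_add, add_mul, add_mul, add_mul, vecMulVec_mul, hD, mul_vecMulVec,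
    vecMulVec_mul_vecMulVec, h1b, vecMulVec_mul, hb, sub_mul, hMD, sub_mulVec]
  simp only [mul_sub, smul_mul_assoc, one_mul, mul_smul_comm, mul_one, smul_mulVec, one_mulVec]
  ext i j
  simp only [Matrix.add_apply, Matrix.sub_apply, vecMulVec_apply, Pi.sub_apply,
    Pi.zero_apply, Pi.add_apply, one_smul, two_smul]
  ring

/-- Differencing telescopes: `1 - S`, with `S` the unit shift, intertwines the adjacency matrix with
the doubling matrix. It is singular, hence the rank-one completion at `0`. -/
theorem det_two_sub_deBruijnMatrix {n : ℕ} [NeZero n] {R : Type*} [CommRing R] [IsDomain R] :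
    (2 • 1 - deBruijnMatrix n R +
        vecMulVec (deBruijnMatrix n R *ᵥ Pi.single 0 1 - Pi.single 0 1) 1).det =
      (2 • 1 - doublingMatrix n R).det := by
  let D : Matrix (ZMod n) (ZMod n) R :=
    (1 - of fun i j => if i + 1 = j then (1 : R) else 0) + vecMulVec (Pi.single 0 1) (Pi.single 0 1)
  have hD : D.det ≠ 0 := by
    rw [Ne, ← exists_mulVec_eq_zero_iff]
    rintro ⟨z, hz, hDz⟩
    have hrow : ∀ i, z i - z (i + 1) + (if i = 0 then z 0 else 0) = 0 := by
      intro i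
      have := congrFun hDz i
      simp only [D, add_mulVec, sub_mulVec, one_mulVec, vecMulVec_mulVec] at this
      simpa [mulVec, dotProduct, Pi.single_apply] using this
    have hz0 : z 0 = 0 := by
      have := Finset.sum_eq_zero fun i (_ : i ∈ Finset.univ) => hrow i
      rw [Finset.sum_add_distrib, Finset.sum_sub_distrib,
        show ∑ i, z (i + 1) = ∑ i, z i from Equiv.sum_comp (Equiv.addRight (1 : ZMod n)) z] at this
      simpa using this
    have hk : ∀ k : ℕ, z k = 0 := by
      intro k
      induction k with
      | zero => simpa using hz0
      | succ k ih => simpa [ih, hz0] using hrow k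
    exact hz (funext fun i => by simpa using hk i.val)
  refine mul_right_cancel₀ hD ?_
  rw [← det_mul, mul_comm (det _) D.det, ← det_mul]
  congr 1
  have hM1 : 1 ᵥ* (1 - of fun i j : ZMod n => if i + 1 = j then (1 : R) else 0) = 0 := by
    ext j
    rw [vecMul_sub, vecMul_one]
    simp [vecMul, dotProduct, ← eq_sub_iff_add_eq]
  have hMD : deBruijnMatrix n R * (1 - of fun i j => if i + 1 = j then (1 : R) else 0) =
      (1 - of fun i j => if i + 1 = j then (1 : R) else 0) * doublingMatrix n R := by
    rw [mul_sub, sub_mul, mul_one, one_mul]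
    ext i j
    simp only [Matrix.sub_apply, mul_apply, deBruijnMatrix,
      doublingMatrix, of_apply, add_mul, Finset.sum_add_distrib, ite_mul, zero_mul, one_mul,
      Finset.sum_ite_eq, Finset.mem_univ, if_true]
    rw [show 2 * (i + 1) = 2 * i + 1 + 1 by ring]
    ring
  have hb : Pi.single (0 : ZMod n) (1 : R) ᵥ* (2 • 1 - doublingMatrix n R) = Pi.single 0 1 := by
    ext j
    simp only [single_one_vecMul, Matrix.sub_apply, Matrix.smul_apply, Matrix.one_apply,
      doublingMatrix, of_apply, mul_zero, Pi.single_apply, row_apply]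
    by_cases hj : 0 = j
    · subst hj; norm_num
    · simp [hj, Ne.symm hj]
  exact mul_add_vecMulVec_of_intertwine hM1 hMD hb (by simp)

theorem card_blockPerm_cycle {n : ℕ} [NeZero n] :
    (n : ℚ) * Fintype.card {s : ZMod n → Bool //
      Function.minimalPeriod (blockPerm s) (edgeEquiv n (.inl 0)) = 2 * n} =
    (2 • 1 - doublingMatrix n ℚ).det := by
  -- The total of `u` over vertices is `(2 - 1) / 4`, hence `1 / 2` over edges, so each full cycle
  -- contributes `(1 / 2) * (2 * n) = n`.
  let u : ZMod n → ℚ :=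
    (4 : ℚ)⁻¹ • (deBruijnMatrix n ℚ *ᵥ Pi.single 0 1 - Pi.single 0 1)
  have h4 : 4 • u = deBruijnMatrix n ℚ *ᵥ Pi.single 0 1 - Pi.single 0 1 := by
    ext i; simp [u]
  have hu : ∑ i, u i = 1 / 4 := by
    have := sum_deBruijnMatrix (n := n) ℚ 0
    simp only [u, Pi.smul_apply, Pi.sub_apply, mulVec_single_one, col_apply, smul_eq_mul,
      ← Finset.mul_sum, Finset.sum_sub_distrib, this]
    simp
    norm_num
  have hue : ∑ e : Fin (2 * n), u (e : ℕ) = 1 / 2 := by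
    rw [← (edgeEquiv n).sum_comp]
    simp only [Fintype.sum_sum_type, natCast_edgeEquiv_inl, natCast_edgeEquiv_inr, hu]
    norm_num
  rw [← det_two_sub_deBruijnMatrix, ← h4, ← sum_det_one_sub_blockPerm]
  simp only [det_one_sub_perm_add_vecMulVec _ (edgeEquiv n (.inl 0)), hue, Fintype.card_fin]
  rw [← Finset.sum_filter, Finset.sum_const, Fintype.card_subtype, nsmul_eq_mul]
  simp
  ring

end CircularWord

/-! ### Passing from `2 * m` to `m` -/

open Matrix in
theorem Matrix.det_fromBlocks_of_add_eq_add {m R : Type*} [Fintype m] [DecidableEq m] [CommRing R]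
    {A B C D : Matrix m m R} (h : C + D = A + B) :
    (fromBlocks A B C D).det = (A + B).det * (D - B).det := by
  have key : fromBlocks 1 0 (-1) 1 * fromBlocks A B C D * fromBlocks 1 0 1 1 =
      fromBlocks (A + B) B 0 (D - B) := by
    simp only [fromBlocks_multiply, one_mul, zero_mul, neg_mul, mul_one, mul_zero, add_zero,
      zero_add]
    congr 1
    · rw [← sub_eq_zero] at h
      rw [← h]; abel
    · abel
  have := congrArg det key
  simpa [det_mul] using this

theorem ZMod.finEquiv_apply {n : ℕ} [NeZero n] (i : Fin n) : ZMod.finEquiv n i = (i : ℕ) := by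
  obtain ⟨n, rfl⟩ := Nat.exists_eq_succ_of_ne_zero (NeZero.ne n)
  exact (Fin.cast_val_eq_self i).symm

namespace CircularWord

open Matrix

/-- The splitting of `ZMod (2 * m)` into residues below `m` and residues at least `m`. -/
noncomputable def halvesEquiv (m : ℕ) [NeZero m] : ZMod m ⊕ ZMod m ≃ ZMod (2 * m) :=
  (edgeEquiv m).trans (ZMod.finEquiv (2 * m)).toEquiv

theorem halvesEquiv_inl {m : ℕ} [NeZero m] (i : ZMod m) :
    halvesEquiv m (.inl i) = (i.val : ℕ) := by
  simp [halvesEquiv, ZMod.finEquiv_apply, edgeEquiv_inl]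

theorem halvesEquiv_inr {m : ℕ} [NeZero m] (i : ZMod m) :
    halvesEquiv m (.inr i) = (i.val : ℕ) + (m : ℕ) := by
  simp [halvesEquiv, ZMod.finEquiv_apply, edgeEquiv_inr, add_comm]

theorem natCast_add_self_half (m : ℕ) : (m : ZMod (2 * m)) + m = 0 := by
  have := ZMod.natCast_self (2 * m)
  push_cast at this
  rw [← two_mul, this]

/-- Reduction from `ZMod (2 * m)` to `ZMod m`. -/
def halfCast (m : ℕ) : ZMod (2 * m) →+* ZMod m := ZMod.castHom (Dvd.intro_left 2 rfl) (ZMod m)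

theorem halfCast_halvesEquiv {m : ℕ} [NeZero m] (x : ZMod m ⊕ ZMod m) :
    halfCast m (halvesEquiv m x) = Sum.elim id id x := by
  rcases x with i | i
  · simp [halvesEquiv_inl]
  · simp [halvesEquiv_inr]

theorem apply_add_apply_add_half {m : ℕ} [NeZero m] {R : Type*} [AddCommMonoid R]
    (w : ZMod (2 * m) → R) (x : ZMod (2 * m)) :
    w x + w (x + m) =
      w (halvesEquiv m (.inl (halfCast m x))) + w (halvesEquiv m (.inr (halfCast m x))) := by
  obtain ⟨y, rfl⟩ := (halvesEquiv m).surjective x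
  rw [halfCast_halvesEquiv]
  rcases y with i | i
  · simp [halvesEquiv_inl, halvesEquiv_inr]
  · simp only [halvesEquiv_inl, halvesEquiv_inr, Sum.elim_inr, id]
    rw [add_assoc, natCast_add_self_half, add_zero, add_comm]

theorem ite_halvesEquiv_add {m : ℕ} [NeZero m] {R : Type*} [Semiring R] (x : ZMod (2 * m))
    (j : ZMod m) :
    (if x = halvesEquiv m (.inl j) then (1 : R) else 0) +
      (if x = halvesEquiv m (.inr j) then 1 else 0) = if halfCast m x = j then 1 else 0 := by
  obtain ⟨y, rfl⟩ := (halvesEquiv m).surjective x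
  rw [halfCast_halvesEquiv]
  rcases y with i | i <;> simp <;> congr

/-- Since `2 * i = 2 * (i + m)` modulo `2 * m`, both halves have the same doubling rows. Their
difference leaves only `2 • 1`, whence the factor `2 ^ m`. -/
theorem det_two_sub_doublingMatrix_two_mul (m : ℕ) [NeZero m] (R : Type*) [CommRing R] :
    (2 • 1 - doublingMatrix (2 * m) R).det = 2 ^ m * (2 • 1 - doublingMatrix m R).det := by
  rw [← det_submatrix_equiv_self (halvesEquiv m)]
  let P : Matrix (ZMod m) (ZMod m) R := of fun i j =>
    if 2 * (i.val : ZMod (2 * m)) = halvesEquiv m (.inl j) then 1 else 0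
  let Q : Matrix (ZMod m) (ZMod m) R := of fun i j =>
    if 2 * (i.val : ZMod (2 * m)) = halvesEquiv m (.inr j) then 1 else 0
  have hPQ : P + Q = doublingMatrix m R := by
    have h2 : halfCast m 2 = 2 := map_ofNat _ 2
    ext i j
    simp [P, Q, ite_halvesEquiv_add, doublingMatrix, h2]
  have hm : (2 : ZMod (2 * m)) * m = 0 :=
    (two_mul (m : ZMod (2 * m))).trans (natCast_add_self_half m)
  have hdbl : ∀ i, 2 * halvesEquiv m (.inr i) = 2 * (i.val : ZMod (2 * m)) := fun i => by
    rw [halvesEquiv_inr, mul_add, hm, add_zero]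
  have hb : (2 • 1 - doublingMatrix (2 * m) R).submatrix (halvesEquiv m) (halvesEquiv m) =
      fromBlocks (2 • 1 - P) (-Q) (-P) (2 • 1 - Q) := by
    ext (i | i) (j | j) <;>
    simp only [submatrix_apply, Matrix.sub_apply, Matrix.smul_apply, one_apply, doublingMatrix,
      of_apply, (halvesEquiv m).injective.eq_iff, hdbl, P, Q, fromBlocks_apply₁₁,
      fromBlocks_apply₁₂, fromBlocks_apply₂₁, fromBlocks_apply₂₂, Matrix.neg_apply,
      Sum.inl.injEq, Sum.inr.injEq, reduceCtorEq, if_false, smul_zero, zero_sub,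
      ← halvesEquiv_inl]
  rw [hb, det_fromBlocks_of_add_eq_add (by abel), ← hPQ, mul_comm]
  congr 1
  · rw [sub_neg_eq_add, sub_add_cancel, ← Nat.cast_smul_eq_nsmul R, det_smul]
    simp
  · congr 1; abel

theorem det_circulant_two_mul (m : ℕ) [NeZero m] (w : ZMod (2 * m) → ZMod 2) :
    (circulant w).det =
      (circulant fun i => w (halvesEquiv m (.inl i)) + w (halvesEquiv m (.inr i))).det ^ 2 := by
  rw [← det_submatrix_equiv_self (halvesEquiv m)]
  let A : Matrix (ZMod m) (ZMod m) (ZMod 2) := of fun i j =>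
    w ((i.val : ZMod (2 * m)) - (j.val : ZMod (2 * m)))
  let B : Matrix (ZMod m) (ZMod m) (ZMod 2) := of fun i j =>
    w ((i.val : ZMod (2 * m)) - (j.val : ZMod (2 * m)) + m)
  have hAB : A + B = circulant fun i =>
      w (halvesEquiv m (.inl i)) + w (halvesEquiv m (.inr i)) := by
    ext i j
    simp [A, B, apply_add_apply_add_half]
  have hneg : -(m : ZMod (2 * m)) = m := neg_eq_of_add_eq_zero_left (natCast_add_self_half m)
  have hb : (circulant w).submatrix (halvesEquiv m) (halvesEquiv m) = fromBlocks A B B A := by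
    ext (i | i) (j | j)
    · simp [A, halvesEquiv_inl]
    · simp only [submatrix_apply, circulant_apply, halvesEquiv_inl, halvesEquiv_inr,
        fromBlocks_apply₁₂, B, of_apply]
      rw [sub_add_eq_sub_sub, sub_eq_add_neg _ (m : ZMod (2 * m)), hneg]
    · simp only [submatrix_apply, circulant_apply, halvesEquiv_inl, halvesEquiv_inr,
        fromBlocks_apply₂₁, B, of_apply]
      rw [add_sub_right_comm]
    · simp [A, halvesEquiv_inr]
  rw [hb, det_fromBlocks_of_add_eq_add (add_comm _ _), hAB, sq]
  congr 2
  rw [← hAB]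
  ext i j
  simp [CharTwo.sub_eq_add]

/-- By `det_circulant_two_mul`, invertibility depends only on the sum of the two halves of `w`; one
half remains free. -/
theorem card_det_circulant_ne_zero_two_mul (m : ℕ) [NeZero m] :
    Nat.card {w : ZMod (2 * m) → ZMod 2 // (circulant w).det ≠ 0} =
      2 ^ m * Nat.card {w : ZMod m → ZMod 2 // (circulant w).det ≠ 0} := by
  let e : (ZMod (2 * m) → ZMod 2) ≃ (ZMod m → ZMod 2) × (ZMod m → ZMod 2) :=
    ((Equiv.arrowCongr (halvesEquiv m).symm (Equiv.refl _)).trans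
      (Equiv.sumArrowEquivProdArrow _ _ _)).trans
      { toFun := fun p => (p.2, p.1 + p.2)
        invFun := fun p => (p.2 - p.1, p.1)
        left_inv := fun p => by simp
        right_inv := fun p => by simp }
  have he : ∀ w, (e w).2 = fun i => w (halvesEquiv m (.inl i)) + w (halvesEquiv m (.inr i)) :=
    fun w => rfl
  have h1 : {w : ZMod (2 * m) → ZMod 2 // (circulant w).det ≠ 0} ≃
      {p : (ZMod m → ZMod 2) × (ZMod m → ZMod 2) // True ∧ (circulant p.2).det ≠ 0} :=
    e.subtypeEquiv fun w => by rw [det_circulant_two_mul, he]; simp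
  rw [Nat.card_congr (h1.trans (Equiv.subtypeProdEquivProd (p := fun _ => True)
      (q := fun w : ZMod m → ZMod 2 => (circulant w).det ≠ 0))), Nat.card_prod,
    Nat.card_congr (Equiv.subtypeUnivEquiv fun _ => trivial)]
  simp
end CircularWord

/-! ### Multiplicative systems in a cyclic group -/

namespace CircularWord

open Matrix

theorem card_quotient_range_mulVecLin {ι : Type*} [Fintype ι] [DecidableEq ι] (B : Matrix ι ι ℤ)
    (hB : Function.Injective B.mulVecLin) :
    Nat.card ((ι → ℤ) ⧸ LinearMap.range B.mulVecLin) = B.det.natAbs := by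
  rw [← Submodule.natAbs_det_equiv _ (LinearEquiv.ofInjective B.mulVecLin hB), ← LinearMap.det_toLin']
  rfl

/-- Solutions of a system of multiplicative equations in a cyclic group of order `N`. -/
theorem card_cyclic_solutions {ι G : Type*} [Fintype ι] [DecidableEq ι] [CommGroup G]
    {g : G} (hg : ∀ x : G, x ∈ Subgroup.zpowers g) (B B' : Matrix ι ι ℤ) (hN : orderOf g ≠ 0)
    (h : B * B' = (orderOf g : ℤ) • 1) (h' : B' * B = (orderOf g : ℤ) • 1) :
    Nat.card {f : ι → G // ∀ i, ∏ j, f j ^ B i j = 1} = B.det.natAbs := by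
  have hN' : (orderOf g : ℤ) ≠ 0 := by exact_mod_cast hN
  have hcancel : ∀ v w : ι → ℤ, (orderOf g : ℤ) • v = (orderOf g : ℤ) • w → v = w :=
    fun v w hvw => smul_right_injective _ hN' hvw
  have hBB' : ∀ v, B *ᵥ (B' *ᵥ v) = (orderOf g : ℤ) • v := fun v => by
    rw [mulVec_mulVec, h, smul_mulVec, one_mulVec]
  have hB'B : ∀ v, B' *ᵥ (B *ᵥ v) = (orderOf g : ℤ) • v := fun v => by
    rw [mulVec_mulVec, h', smul_mulVec, one_mulVec]
  have hBinj : Function.Injective B.mulVecLin := fun v w hvw => by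
    apply hcancel
    rw [← hB'B, ← hB'B]
    exact congrArg (B' *ᵥ ·) hvw
  have hmem : ∀ y : ι → ℤ, ∀ i, ∏ j, (g ^ y j) ^ B i j = g ^ (B *ᵥ y) i := by
    intro y i
    have hsum : ∀ (s : Finset ι) (k : ι → ℤ), ∏ j ∈ s, g ^ k j = g ^ ∑ j ∈ s, k j := by
      intro s k
      induction s using Finset.induction_on with
      | empty => simp
      | insert a s ha ih =>
        rw [Finset.prod_insert ha, Finset.sum_insert ha, _root_.zpow_add, ih]
    simp only [mulVec, dotProduct, ← _root_.zpow_mul, mul_comm (y _), hsum]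
  have hz : ∀ k : ℤ, g ^ k = 1 ↔ (orderOf g : ℤ) ∣ k := fun k => (orderOf_dvd_iff_zpow_eq_one).symm
  -- Exponents `y` solve the system iff `B y = N x` for some `x`, with `N` the order of `g`;
  -- applying `B'` gives `y = B' x`. So solutions correspond to the cokernel of `B`, which has order
  -- `|det B|`.
  let Φ : (ι → ℤ) → {f : ι → G // ∀ i, ∏ j, f j ^ B i j = 1} := fun x =>
    ⟨fun j => g ^ (B' *ᵥ x) j, fun i => by rw [hmem, hBB', hz]; simp⟩
  have hΦ : ∀ x y, Φ x = Φ y ↔ x - y ∈ LinearMap.range B.mulVecLin := by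
    intro x y
    have h1 : Φ x = Φ y ↔ ∀ j, (orderOf g : ℤ) ∣ (B' *ᵥ (x - y)) j := by
      simp only [Φ, Subtype.mk.injEq, funext_iff, mulVec_sub, Pi.sub_apply, ← hz,
        _root_.zpow_sub, mul_inv_eq_one]
    rw [h1]
    constructor
    · intro hd
      choose z hz using hd
      refine ⟨z, hcancel _ _ ?_⟩
      have : B' *ᵥ (x - y) = (orderOf g : ℤ) • z := funext hz
      rw [← hBB' (x - y), this, mulVec_smul]
      rfl
    · rintro ⟨z, hz⟩ j
      rw [← hz, mulVecLin_apply, hB'B]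
      simp
  have hsurj : Function.Surjective Φ := by
    rintro ⟨f, hf⟩
    choose y hy using fun j => Subgroup.mem_zpowers_iff.1 (hg (f j))
    have hd : ∀ i, (orderOf g : ℤ) ∣ (B *ᵥ y) i := fun i => by
      rw [← hz, ← hmem, ← hf i]
      simp only [hy]
    choose x hx using hd
    refine ⟨x, Subtype.ext (funext fun j => ?_)⟩
    have hxy : B' *ᵥ x = y := by
      apply hcancel
      rw [← mulVec_smul, ← hB'B y]
      exact congrArg (B' *ᵥ ·) (funext hx).symm
    change g ^ (B' *ᵥ x) j = f j
    rw [hxy, hy]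
  rw [← card_quotient_range_mulVecLin B hBinj]
  symm
  refine Nat.card_eq_of_bijective (Quotient.lift Φ fun x y hxy => ?_) ⟨?_, ?_⟩
  · rw [hΦ, ← Submodule.quotientRel_def]
    exact hxy
  · rintro ⟨x⟩ ⟨y⟩ hxy
    exact (Submodule.Quotient.eq _).2 ((hΦ x y).1 hxy)
  · intro f
    obtain ⟨x, rfl⟩ := hsurj f
    exact ⟨Submodule.Quotient.mk x, rfl⟩

theorem doublingMatrix_pow (n : ℕ) [NeZero n] (R : Type*) [CommRing R] (k : ℕ) :
    doublingMatrix n R ^ k = of fun i j => if 2 ^ k * i = j then 1 else 0 := by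
  induction k with
  | zero => ext i j; simp [one_apply]
  | succ k ih =>
    rw [pow_succ', ih]
    ext i j
    simp only [mul_apply, doublingMatrix, of_apply, ite_mul, one_mul, zero_mul, Finset.sum_ite_eq,
      Finset.mem_univ, if_true, pow_succ, mul_assoc]

/-- Here `T ^ D = 1`, so the geometric sum factors `2 ^ D - 1` through `2 - T` and supplies the
complementary matrix. -/
theorem card_doubling_solutions {n D : ℕ} [NeZero n] {G : Type*} [CommGroup G] {g : G}
    (hg : ∀ x : G, x ∈ Subgroup.zpowers g) (hD : D ≠ 0) (hn : (2 : ZMod n) ^ D = 1)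
    (hord : orderOf g = 2 ^ D - 1) :
    Nat.card {f : ZMod n → G // ∀ i, f (2 * i) = f i ^ 2} =
      (2 • 1 - doublingMatrix n ℤ).det.natAbs := by
  have hcomm : Commute (2 • 1 : Matrix (ZMod n) (ZMod n) ℤ) (doublingMatrix n ℤ) :=
    (Commute.one_left _).smul_left 2
  have hpow : (2 • 1 : Matrix (ZMod n) (ZMod n) ℤ) ^ D - doublingMatrix n ℤ ^ D =
      (orderOf g : ℤ) • 1 := by
    have h1 : 1 ≤ 2 ^ D := Nat.one_le_two_pow
    have h2 : doublingMatrix n ℤ ^ D = 1 := by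
      ext i j
      simp [doublingMatrix_pow, hn, one_apply]
    rw [h2, hord, smul_pow, one_pow, Nat.cast_sub h1, sub_smul, Nat.cast_smul_eq_nsmul,
      Nat.cast_one, one_smul]
  have hord0 : orderOf g ≠ 0 := by
    have := Nat.one_lt_two_pow hD
    omega
  rw [← card_cyclic_solutions hg _
    (∑ i ∈ Finset.range D, (2 • 1) ^ i * doublingMatrix n ℤ ^ (D - 1 - i)) hord0
    ((hcomm.mul_geom_sum₂ D).trans hpow) ((hcomm.geom_sum₂_mul D).trans hpow)]
  refine Nat.card_congr (Equiv.subtypeEquivRight fun f => forall_congr' fun i => ?_)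
  have h1 : ∀ j, f j ^ (2 • (1 : Matrix (ZMod n) (ZMod n) ℤ) - doublingMatrix n ℤ) i j =
      (if i = j then f j ^ 2 else 1) * (if 2 * i = j then (f j)⁻¹ else 1) := by
    intro j
    simp only [Matrix.sub_apply, Matrix.smul_apply, one_apply, doublingMatrix, of_apply,
      _root_.zpow_sub]
    congr 1
    · split_ifs
      · rw [show 2 • (1 : ℤ) = ((2 : ℕ) : ℤ) by norm_num, _root_.zpow_natCast]
      · simp
    · split_ifs <;> simp
  have h2 : ∏ j, f j ^ (2 • (1 : Matrix (ZMod n) (ZMod n) ℤ) - doublingMatrix n ℤ) i j =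
      f i ^ 2 * (f (2 * i))⁻¹ := by
    simp only [h1, Finset.prod_mul_distrib, Finset.prod_ite_eq, Finset.mem_univ, if_true]
  rw [h2, mul_inv_eq_one, eq_comm]

end CircularWord

/-! ### Invertible circulants by Fourier transform -/

namespace CircularWord

open Matrix

theorem circulant_mul_fourier {n : ℕ} [NeZero n] {K : Type*} [Field K] (ψ : AddChar (ZMod n) K)
    (w : ZMod n → K) :
    circulant w * of (fun i j => ψ (i * j)) =
      of (fun i j => ψ (i * j)) * diagonal fun j => ∑ i, w i * ψ (i * -j) := by
  ext i k
  rw [mul_diagonal, mul_apply, ← (Equiv.subLeft i).sum_comp]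
  simp only [circulant_apply, of_apply, Equiv.subLeft_apply, sub_sub_cancel, Finset.mul_sum]
  refine Finset.sum_congr rfl fun j _ => ?_
  rw [sub_mul, sub_eq_add_neg, AddChar.map_add_eq_mul, mul_neg]
  ring

theorem fourier_mul_fourier_neg {n : ℕ} [NeZero n] {K : Type*} [Field K] {ψ : AddChar (ZMod n) K}
    (hψ : ψ.IsPrimitive) :
    of (fun i j => ψ (i * j)) * of (fun i j => ψ (i * -j)) =
      (n : K) • (1 : Matrix (ZMod n) (ZMod n) K) := by
  ext i k
  have h : ∀ j, ψ (i * j) * ψ (j * -k) = ψ (j * (i - k)) := fun j => by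
    rw [← AddChar.map_add_eq_mul]; congr 1; ring
  simp only [mul_apply, of_apply, h, AddChar.sum_mulShift _ hψ, ZMod.card, Matrix.smul_apply,
    one_apply, sub_eq_zero, smul_eq_mul]
  split_ifs <;> simp

theorem fourier_sq {n : ℕ} [NeZero n] {K : Type*} [Field K] [Algebra (ZMod 2) K]
    (ψ : AddChar (ZMod n) K) (w : ZMod n → ZMod 2) (j : ZMod n) :
    (∑ i, algebraMap (ZMod 2) K (w i) * ψ (i * j)) ^ 2 =
      ∑ i, algebraMap (ZMod 2) K (w i) * ψ (i * (2 * j)) := by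
  have : CharP K 2 := charP_of_injective_algebraMap (algebraMap (ZMod 2) K).injective 2
  rw [sum_pow_char]
  refine Finset.sum_congr rfl fun i _ => ?_
  rw [mul_pow, ← map_pow, ZMod.pow_card, ← AddChar.map_nsmul_eq_pow]
  congr 2
  simp only [nsmul_eq_mul]
  push_cast
  ring

/-- The Fourier matrix diagonalizes circulants, so invertibility means a nowhere zero transform;
coefficients lie in the prime field exactly when the transform commutes with doubling and squaring.
-/
theorem card_det_circulant_ne_zero_eq_card_units {n : ℕ} [NeZero n] (hodd : Odd n) {K : Type*}
    [Field K] [Algebra (ZMod 2) K] {ψ : AddChar (ZMod n) K} (hψ : ψ.IsPrimitive) :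
    Nat.card {w : ZMod n → ZMod 2 // (circulant w).det ≠ 0} =
      Nat.card {f : ZMod n → Kˣ // ∀ j, f (2 * j) = f j ^ 2} := by
  have hchar : CharP K 2 := charP_of_injective_algebraMap (algebraMap (ZMod 2) K).injective 2
  have hnK : (n : K) = 1 := by
    obtain ⟨k, rfl⟩ := hodd
    push_cast
    rw [CharTwo.two_eq_zero, zero_mul, zero_add]
  let V : Matrix (ZMod n) (ZMod n) K := of fun i j => ψ (i * j)
  let V' : Matrix (ZMod n) (ZMod n) K := of fun i j => ψ (i * -j)
  have hVV' : V * V' = 1 := by rw [fourier_mul_fourier_neg hψ, hnK, one_smul]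
  have hV'V : V' * V = 1 := mul_eq_one_comm.1 hVV'
  have hV : V.det ≠ 0 := fun h => by
    have := congrArg det hVV'
    simp [h] at this
  let dft : (ZMod n → ZMod 2) → ZMod n → K := fun w j =>
    ∑ i, algebraMap (ZMod 2) K (w i) * ψ (i * j)
  have hdftV : ∀ w, dft w = (fun i => algebraMap (ZMod 2) K (w i)) ᵥ* V := fun w => rfl
  have hdet : ∀ w, (circulant w).det ≠ 0 ↔ ∀ j, dft w j ≠ 0 := by
    intro w
    have h1 := congrArg det (circulant_mul_fourier ψ fun i => algebraMap (ZMod 2) K (w i))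
    rw [det_mul, det_mul, det_diagonal, mul_comm] at h1
    have h2 := mul_left_cancel₀ hV h1
    have h3 : (circulant fun i => algebraMap (ZMod 2) K (w i)).det =
        algebraMap (ZMod 2) K (circulant w).det := by
      rw [RingHom.map_det]
      congr 1
    rw [← map_ne_zero (algebraMap (ZMod 2) K), ← h3, h2, Finset.prod_ne_zero_iff]
    refine ⟨fun h j => ?_, fun h j _ => h (-j)⟩
    have := h (-j) (Finset.mem_univ _)
    rwa [neg_neg] at this
  refine Nat.card_eq_of_bijective
    (fun w => ⟨fun j => Units.mk0 (dft w.1 j) ((hdet w.1).1 w.2 j), fun j => Units.ext ?_⟩)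
    ⟨?_, ?_⟩
  · exact (fourier_sq ψ w.1 j).symm
  · rintro ⟨w, hw⟩ ⟨w', hw'⟩ h
    have h1 : dft w = dft w' := funext fun j =>
      congrArg Units.val (congrFun (congrArg Subtype.val h) j)
    rw [hdftV, hdftV] at h1
    have h2 := congrArg (· ᵥ* V') h1
    simp only [vecMul_vecMul, hVV', vecMul_one] at h2
    exact Subtype.ext (funext fun i => (algebraMap (ZMod 2) K).injective (congrFun h2 i))
  · rintro ⟨f, hf⟩
    have h2 : IsUnit (2 : ZMod n) := by
      have := (ZMod.isUnit_iff_coprime 2 n).2 (Nat.coprime_two_left.2 hodd)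
      exact_mod_cast this
    let c : ZMod n → K := (fun j => (f j : K)) ᵥ* V'
    have hcV : c ᵥ* V = fun j => (f j : K) := by
      rw [vecMul_vecMul, hV'V, vecMul_one]
    have hcV' : ∀ j, ∑ i, c i * ψ (i * j) = f j := fun j => congrFun hcV j
    -- As 2 is a unit modulo `n`, every frequency is a double, so `c` and its square have equal
    -- transforms. Hence each `c i` is idempotent.
    have hc2V : (fun i => c i ^ 2) ᵥ* V = c ᵥ* V := by
      ext k
      obtain ⟨j, rfl⟩ : ∃ j, 2 * j = k := ⟨h2.unit⁻¹ * k, by simp [← mul_assoc]⟩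
      rw [hcV]
      change ∑ i, c i ^ 2 * ψ (i * (2 * j)) = f (2 * j)
      rw [hf, Units.val_pow_eq_pow_val, ← hcV' j, sum_pow_char]
      refine Finset.sum_congr rfl fun i _ => ?_
      rw [mul_pow, ← AddChar.map_nsmul_eq_pow]
      congr 2
      simp only [nsmul_eq_mul]
      push_cast
      ring
    have hc2 : ∀ i, c i ^ 2 = c i := by
      have := congrArg (· ᵥ* V') hc2V
      simp only [vecMul_vecMul, hVV', vecMul_one] at this
      exact fun i => congrFun this i
    have hc : ∀ i, ∃ a : ZMod 2, algebraMap (ZMod 2) K a = c i := by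
      intro i
      have : c i * (c i - 1) = 0 := by rw [mul_sub, ← sq, hc2]; simp
      rcases mul_eq_zero.1 this with h | h
      · exact ⟨0, by simp [h]⟩
      · exact ⟨1, by simp [sub_eq_zero.1 h]⟩
    choose w hw using hc
    have hwf : ∀ j, dft w j = f j := fun j => by
      simp only [dft, hw, hcV']
    refine ⟨⟨w, (hdet w).2 fun j => by rw [hwf]; exact (f j).ne_zero⟩, ?_⟩
    exact Subtype.ext (funext fun j => Units.ext (hwf j))

theorem card_det_circulant_ne_zero_of_odd {n : ℕ} [NeZero n] (hodd : Odd n) :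
    Nat.card {w : ZMod n → ZMod 2 // (circulant w).det ≠ 0} =
      (2 • 1 - doublingMatrix n ℤ).det.natAbs := by
  -- By Euler's theorem `n` divides `2 ^ D - 1`, so the field with `2 ^ D` elements contains a
  -- primitive `n`-th root of unity.
  set D := n.totient with hDdef
  have hD : D ≠ 0 := (Nat.totient_pos.2 (NeZero.pos n)).ne'
  have hcop : Nat.Coprime 2 n := Nat.coprime_two_left.2 hodd
  have h2D : (2 : ZMod n) ^ D = 1 := by
    have := (ZMod.natCast_eq_natCast_iff _ _ _).2 (Nat.ModEq.pow_totient hcop)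
    push_cast at this
    exact this
  let K := GaloisField 2 D
  have hcardK : Nat.card Kˣ = 2 ^ D - 1 := by
    rw [Nat.card_units, GaloisField.card 2 D hD]
  obtain ⟨g, hg⟩ := IsCyclic.exists_generator (α := Kˣ)
  have hord : orderOf g = 2 ^ D - 1 := by rw [orderOf_eq_card_of_forall_mem_zpowers hg, hcardK]
  have hdvd : n ∣ orderOf g := by
    rw [hord, ← ZMod.natCast_eq_zero_iff, Nat.cast_sub Nat.one_le_two_pow]
    push_cast
    rw [h2D, sub_self]
  have hord0 : orderOf g ≠ 0 := by
    have := Nat.one_lt_two_pow hD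
    omega
  have hζ : IsPrimitiveRoot ((g ^ (orderOf g / n) : Kˣ) : K) n := by
    rw [IsPrimitiveRoot.coe_units_iff]
    have := IsPrimitiveRoot.orderOf (g ^ (orderOf g / n))
    rwa [orderOf_pow_orderOf_div hord0 hdvd] at this
  rw [card_det_circulant_ne_zero_eq_card_units hodd
    (AddChar.zmodChar_primitive_of_primitive_root n hζ), card_doubling_solutions hg hD h2D hord]

theorem card_det_circulant_ne_zero (n : ℕ) [hn : NeZero n] :
    Nat.card {w : ZMod n → ZMod 2 // (circulant w).det ≠ 0} =
      (2 • 1 - doublingMatrix n ℤ).det.natAbs := by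
  revert hn
  induction n using Nat.strong_induction_on with
  | _ n ih =>
    intro hn
    rcases Nat.even_or_odd' n with ⟨m, rfl | rfl⟩
    · have hm : m ≠ 0 := fun h => NeZero.ne (2 * m) (by simp [h])
      have : NeZero m := ⟨hm⟩
      have := ih m (by omega)
      rw [card_det_circulant_ne_zero_two_mul, this, det_two_sub_doublingMatrix_two_mul,
        Int.natAbs_mul, Int.natAbs_pow]
      rfl
    · exact card_det_circulant_ne_zero_of_odd ⟨m, rfl⟩

end CircularWord

/-! ### Sorted rotations and the Burrows–Wheeler transform -/

namespace CircularWord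

/-- Itineraries are weakly increasing in their starting point: a tie in the first letter is passed
on by `σ` in the same order. -/
theorem not_ofFn_iterate_lt {X α : Type*} [LinearOrder X] [LinearOrder α] {F : X → α} {σ : X → X}
    (hF : Monotone F) (hσ : ∀ e e', e < e' → F e = F e' → σ e < σ e') (m : ℕ) {e e' : X}
    (h : e ≤ e') :
    ¬ (List.ofFn fun k : Fin m => F (σ^[k] e')) < List.ofFn fun k : Fin m => F (σ^[k] e) := by
  induction m generalizing e e' with
  | zero => simp
  | succ m ih =>
    rcases h.eq_or_lt with rfl | h
    · exact lt_irrefl _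
    · rw [List.ofFn_succ, List.ofFn_succ, List.cons_lt_cons_iff, not_or]
      refine ⟨not_lt.2 (hF h.le), ?_⟩
      rintro ⟨h1, h2⟩
      exact ih (hσ e e' h h1.symm).le h2

theorem append_lt_append_of_length_eq {α : Type*} [LinearOrder α] {l l' : List α} (r r' : List α)
    (hlen : l.length = l'.length) (h : l < l') : l ++ r < l' ++ r' := by
  induction l generalizing l' with
  | nil =>
    cases l' with
    | nil => simp at h
    | cons b l' => simp at hlen
  | cons a l ih =>
    cases l' with
    | nil => simp at hlen
    | cons b l' =>
      rw [List.cons_lt_cons_iff] at h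
      rw [List.cons_append, List.cons_append, List.cons_lt_cons_iff]
      exact h.imp_right fun h => ⟨h.1, ih (by simpa using hlen) h.2⟩

theorem filterMap_ofFn_eq {α β : Type*} {m : ℕ} {f : Fin m → α} {g : α → Option β} {h : Fin m → β}
    (hg : ∀ i, g (f i) = some (h i)) : (List.ofFn f).filterMap g = List.ofFn h := by
  induction m with
  | zero => simp
  | succ m ih => simp [List.ofFn_succ, hg, ih fun i => hg i.succ]

/-- The `j`-th rotation of the word `a`. -/
def rotationRow {α : Type*} {N : ℕ} (a : Fin N → α) (j : Fin N) : List α :=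
  List.ofFn fun k => a (k + j)

theorem cyclicPermutations_ofFn {α : Type*} {N : ℕ} [NeZero N] (a : Fin N → α) :
    (List.ofFn a).cyclicPermutations = List.ofFn (rotationRow a) := by
  have hne : List.ofFn a ≠ [] := by
    simp [List.ofFn_eq_nil_iff, NeZero.ne N]
  refine List.ext_getElem (by simp [List.length_cyclicPermutations_of_ne_nil _ hne]) ?_
  intro i h1 h2
  rw [List.getElem_cyclicPermutations, List.getElem_ofFn, rotationRow]
  refine List.ext_getElem (by simp) ?_
  intro k h3 h4
  rw [List.getElem_rotate, List.getElem_ofFn, List.getElem_ofFn]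
  congr 1
  ext
  simp [Fin.val_add]

/-- A sorted list is determined by its multiset, so any sorting permutation will do, however it
breaks ties. -/
theorem bwtRows_ofFn {k N : ℕ} [NeZero N] (a : Fin N → Fin k) (q : Equiv.Perm (Fin N))
    (hq : Monotone (rotationRow a ∘ q)) :
    bwtRows (List.ofFn a : Necklace k) = List.ofFn (rotationRow a ∘ q) := by
  refine List.Perm.eq_of_pairwise' (Multiset.pairwise_sort _ _) hq.sortedLE_ofFn.pairwise ?_
  rw [← Multiset.coe_eq_coe, bwtRows, Multiset.sort_eq, Cycle.lists_coe, cyclicPermutations_ofFn,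
    Multiset.coe_eq_coe]
  exact (Equiv.Perm.ofFn_comp_perm q _).symm

theorem getLast?_rotationRow_add_one {α : Type*} {N : ℕ} [NeZero N] (a : Fin N → α) (j : Fin N) :
    (rotationRow a (j + 1)).getLast? = some (a j) := by
  obtain ⟨M, rfl⟩ := Nat.exists_eq_succ_of_ne_zero (NeZero.ne N)
  rw [rotationRow, List.ofFn_succ_last, List.getLast?_concat]
  congr 2
  rw [add_comm j, ← add_assoc, Fin.last_add_one, zero_add]

theorem bwt_ofFn {k N : ℕ} [NeZero N] (a : Fin N → Fin k) (q : Equiv.Perm (Fin N))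
    (hq : Monotone (rotationRow a ∘ q)) :
    bwt (List.ofFn a : Necklace k) = List.ofFn fun r => a (q r - 1) := by
  rw [bwt, bwtRows_ofFn a q hq]
  refine filterMap_ofFn_eq fun r => ?_
  rw [← getLast?_rotationRow_add_one, sub_add_cancel]
  rfl

theorem rotationRow_add_one_lt {α : Type*} [LinearOrder α] {N : ℕ} [NeZero N] (a : Fin N → α)
    {j j' : Fin N} (ha : a j = a j') (h : rotationRow a j < rotationRow a j') :
    rotationRow a (j + 1) < rotationRow a (j' + 1) := by
  obtain ⟨M, rfl⟩ := Nat.exists_eq_succ_of_ne_zero (NeZero.ne N)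
  have h2 : ∀ j : Fin (M + 1), rotationRow a (j + 1) =
      (List.ofFn fun k : Fin M => a (k.succ + j)) ++ [a j] := by
    intro j
    rw [rotationRow, List.ofFn_succ_last]
    congr 3
    · funext k
      rw [← Fin.coeSucc_eq_succ, add_comm j, ← add_assoc]
    · rw [add_comm j, ← add_assoc, Fin.last_add_one, zero_add]
  rw [h2, h2]
  refine append_lt_append_of_length_eq _ _ (by simp) ?_
  rw [rotationRow, rotationRow, List.ofFn_succ, List.ofFn_succ, List.cons_lt_cons_iff, zero_add,
    zero_add, ha] at h
  exact (h.resolve_left (lt_irrefl _)).2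

theorem apply_le_of_rotationRow_le {α : Type*} [LinearOrder α] {N : ℕ} [NeZero N] (a : Fin N → α)
    {j j' : Fin N} (h : rotationRow a j ≤ rotationRow a j') : a j ≤ a j' := by
  obtain ⟨M, rfl⟩ := Nat.exists_eq_succ_of_ne_zero (NeZero.ne N)
  by_contra! hlt
  refine not_lt.2 h ?_
  rw [rotationRow, rotationRow, List.ofFn_succ, List.ofFn_succ, List.cons_lt_cons_iff, zero_add,
    zero_add]
  exact Or.inl hlt

theorem rotationRow_add_right {α : Type*} {N : ℕ} [NeZero N] (a : Fin N → α) {j j' : Fin N}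
    (h : rotationRow a j = rotationRow a j') (i : Fin N) :
    rotationRow a (i + (j' - j)) = rotationRow a i := by
  have h1 : ∀ k, a (k + j) = a (k + j') := congrFun (List.ofFn_injective h)
  unfold rotationRow
  congr 1
  funext k
  have := h1 (k + i - j)
  rw [sub_add_cancel] at this
  rw [this]
  congr 1
  abel

/-- If the first two letters of the transform differ, the word is primitive: its rotations are
distinct. -/
theorem rotationRow_injective {α : Type*} [LinearOrder α] {N : ℕ} [NeZero N] (a : Fin N → α)
    (q : Equiv.Perm (Fin N)) (hq : Monotone (rotationRow a ∘ q)) {r : Fin N}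
    (hr : (r : ℕ) = 1) (hne : a (q 0 - 1) ≠ a (q r - 1)) :
    Function.Injective (rotationRow a) := by
  intro j j' h
  by_contra hjj
  have h1 := rotationRow_add_right a h (q 0)
  set r' := q.symm (q 0 + (j' - j)) with hr'
  have h2 : q r' = q 0 + (j' - j) := by simp [hr']
  have h3 : r' ≠ 0 := fun h0 => by
    rw [h0] at h2
    exact hjj (sub_eq_zero.1 (left_eq_add.1 h2)).symm
  have h4 : r ≤ r' := by
    rw [Fin.le_def, hr]
    exact Nat.one_le_iff_ne_zero.2 fun h0 => h3 (Fin.ext (by simpa using h0))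
  -- A nontrivial period repeats the least row at `r' ≥ 1`, which squeezes row 1 down to row 0 and
  -- forces equal last letters.
  have h5 : rotationRow a (q r) ≤ rotationRow a (q 0) := by
    have := hq h4
    simpa [h2, h1] using this
  have h6 : rotationRow a (q r) = rotationRow a (q 0) := le_antisymm h5 (hq (Fin.zero_le r))
  have h7 := getLast?_rotationRow_add_one a (q r - 1)
  rw [sub_add_cancel, h6, ← sub_add_cancel (q 0) 1, getLast?_rotationRow_add_one] at h7
  exact hne (Option.some.inj h7)

end CircularWord

/-! ### Inverting the transform -/

namespace CircularWord

open Function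

theorem sortedLetter_monotone {n : ℕ} : Monotone (sortedLetter (n := n)) := by
  intro e e' h
  have h : (e : ℕ) ≤ e' := h
  unfold sortedLetter
  split_ifs
  · exact le_rfl
  · exact Fin.zero_le _
  · omega
  · exact le_rfl

theorem sortedLetter_blockPerm_symm {n : ℕ} (s : ZMod n → Bool) (r : Fin (2 * n)) :
    sortedLetter ((blockPerm s).symm r) = blockLetter s r := by
  have hr := r.isLt
  have h := blockPerm_symm_val s r
  unfold blockLetter at h ⊢
  split_ifs at h ⊢ with h1
  · rw [sortedLetter_eq_zero, h]
    simp
    omega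
  · rw [sortedLetter_eq_one, h]
    simp

theorem blockLetter_blockPerm {n : ℕ} (s : ZMod n → Bool) (e : Fin (2 * n)) :
    blockLetter s (blockPerm s e) = sortedLetter e := by
  rw [← sortedLetter_blockPerm_symm, Equiv.symm_apply_apply]

theorem blockPerm_symm_lt {n : ℕ} (s : ZMod n → Bool) {r r' : Fin (2 * n)} (h : r < r')
    (hv : blockLetter s r = blockLetter s r') :
    (blockPerm s).symm r < (blockPerm s).symm r' := by
  have h : (r : ℕ) < r' := h
  rw [Fin.lt_def, blockPerm_symm_val, blockPerm_symm_val, hv, Nat.add_lt_add_iff_left]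
  by_contra hc
  have hc : (r : ℕ) / 2 = (r' : ℕ) / 2 := by omega
  have h0 : (r : ℕ) % 2 = 0 := by omega
  have h1 : (r' : ℕ) % 2 = 1 := by omega
  unfold blockLetter at hv
  rw [hc, h0, h1] at hv
  cases hs : s ((r' : ℕ) / 2 : ℕ) <;> simp [hs] at hv

theorem blockPerm_lt {n : ℕ} (s : ZMod n → Bool) {e e' : Fin (2 * n)} (h : e < e')
    (hv : sortedLetter e = sortedLetter e') : blockPerm s e < blockPerm s e' := by
  by_contra! hc
  rcases hc.eq_or_lt with hc | hc
  · exact h.ne ((blockPerm s).injective hc).symm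
  · have := blockPerm_symm_lt s hc (by rw [blockLetter_blockPerm, blockLetter_blockPerm, hv])
    simp only [Equiv.symm_apply_apply] at this
    exact lt_asymm h this

/-- The word read off along the orbit of `x` under the permutation defined by `s`. -/
def orbitWord {n : ℕ} (s : ZMod n → Bool) (x : Fin (2 * n)) (k : Fin (2 * n)) : Fin 2 :=
  sortedLetter ((blockPerm s)^[k] x)

/-- Each rotation is the itinerary of a point of `Fin (2 * n)`, and itineraries increase with the
point, so sorting lists the points in order. The letter preceding `r` is that of its preimage. -/
theorem bwt_orbitWord {n : ℕ} [NeZero n] (s : ZMod n → Bool) (x : Fin (2 * n))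
    (hs : minimalPeriod (blockPerm s) x = 2 * n) :
    bwt (List.ofFn (orbitWord s x) : Necklace 2) = List.ofFn (blockLetter s) := by
  have hbij : Bijective fun k : Fin (2 * n) => (blockPerm s)^[k] x := by
    rw [← Finite.injective_iff_bijective]
    exact fun k l hkl => Fin.ext
      (iterate_injOn_Iio_minimalPeriod (by simp [hs]) (by simp [hs]) hkl)
  let p : Equiv.Perm (Fin (2 * n)) := Equiv.ofBijective _ hbij
  have hadd : ∀ k j, (blockPerm s)^[(k + j : Fin (2 * n))] x = (blockPerm s)^[k] (p j) := by
    intro k j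
    have hmod : ∀ m, (blockPerm s)^[m % (2 * n)] x = (blockPerm s)^[m] x := fun m => by
      have := iterate_mod_minimalPeriod_eq (f := blockPerm s) (x := x) (n := m)
      rwa [hs] at this
    rw [Fin.val_add, hmod, iterate_add_apply]
    rfl
  have hsucc : ∀ j, p (j + 1) = blockPerm s (p j) := by
    intro j
    have h1 : ((1 : Fin (2 * n)) : ℕ) = 1 := by
      rw [Fin.val_one', Nat.mod_eq_of_lt]
      have := NeZero.pos n
      omega
    have h2 := hadd 1 j
    rw [add_comm, h1] at h2
    exact h2
  have hrow : ∀ e, rotationRow (orbitWord s x) (p.symm e) =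
      List.ofFn fun k : Fin (2 * n) => sortedLetter ((blockPerm s)^[k] e) := by
    intro e
    unfold rotationRow orbitWord
    congr 1
    funext k
    rw [hadd, Equiv.apply_symm_apply]
  rw [bwt_ofFn _ p.symm]
  · congr 1
    funext r
    rw [orbitWord]
    rw [← blockLetter_blockPerm s]
    congr 1
    change blockPerm s (p (p.symm r - 1)) = r
    rw [← hsucc, sub_add_cancel, Equiv.apply_symm_apply]
  · intro e e' h
    simp only [comp_apply, hrow]
    exact not_lt.1 (not_ofFn_iterate_lt sortedLetter_monotone (fun _ _ => blockPerm_lt s) _ h)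

theorem exists_orbitWord_of_bwt {n : ℕ} [NeZero n] (s : ZMod n → Bool) (x : Fin (2 * n))
    (a : Fin (2 * n) → Fin 2)
    (h : bwt (List.ofFn a : Necklace 2) = List.ofFn (blockLetter s)) :
    minimalPeriod (blockPerm s) x = 2 * n ∧
      (List.ofFn (orbitWord s x) : Necklace 2) = List.ofFn a := by
  have hn := NeZero.pos n
  let q : Equiv.Perm (Fin (2 * n)) := Tuple.sort (rotationRow a)
  have hq : Monotone (rotationRow a ∘ q) := Tuple.monotone_sort _
  have hv : ∀ r, a (q r - 1) = blockLetter s r := by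
    rw [bwt_ofFn a q hq] at h
    exact congrFun (List.ofFn_injective h)
  -- The transform begins with `01` or `10`, so its first two letters differ.
  have hinj : Injective (rotationRow a) := by
    refine rotationRow_injective a q hq (r := ⟨1, by omega⟩) rfl ?_
    rw [hv, hv]
    unfold blockLetter
    cases hs : s 0 <;> simp [hs]
  have hmono : StrictMono (rotationRow a ∘ q) := hq.strictMono_of_injective (hinj.comp q.injective)
  let σ : Equiv.Perm (Fin (2 * n)) := (q.trans (Equiv.addRight 1)).trans q.symm
  have hqσ : ∀ e, q (σ e) = q e + 1 := fun e => by simp [σ]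
  have hvσ : ∀ e, blockLetter s (σ e) = a (q e) := fun e => by
    rw [← hv, hqσ, add_sub_cancel_right]
  have hFmono : Monotone (a ∘ q) := fun e e' hee => apply_le_of_rotationRow_le a (hq hee)
  have hσlt : ∀ e e', e < e' → a (q e) = a (q e') → σ e < σ e' := by
    intro e e' hee ha
    rw [← hmono.lt_iff_lt]
    simp only [comp_apply, hqσ]
    exact rotationRow_add_one_lt a ha (hmono hee)
  let τ : Equiv.Perm (Fin (2 * n)) := σ.trans (blockPerm s).symm
  have hFτ : ∀ e, sortedLetter (τ e) = a (q e) := fun e => by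
    rw [← hvσ, ← sortedLetter_blockPerm_symm]
    rfl
  have hτmono : StrictMono τ := by
    intro e e' hee
    rcases (hFmono hee.le).eq_or_lt with ha | ha
    · exact blockPerm_symm_lt s (hσlt e e' hee ha) (by rw [hvσ, hvσ]; exact ha)
    · refine sortedLetter_monotone.reflect_lt ?_
      rwa [hFτ, hFτ]
  -- A strictly increasing permutation of a finite chain is the identity. Thus `blockPerm s` is
  -- rotation by one seen on sorted rows, a single cycle.
  have hτ : (τ : Fin (2 * n) → Fin (2 * n)) = id := by
    rw [← hτmono.range_inj strictMono_id, τ.surjective.range_eq, Set.range_id]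
  have hσ : blockPerm s = σ := by
    ext1 e
    have : (blockPerm s).symm (σ e) = e := congrFun hτ e
    rw [← this, Equiv.apply_symm_apply, this]
  have hF : ∀ e, sortedLetter e = a (q e) := fun e => by
    rw [← hFτ, hτ]
    rfl
  have hiter : ∀ k : ℕ, q ((blockPerm s)^[k] x) = q x + (Fin.ofNat (2 * n) k) := by
    intro k
    induction k with
    | zero => simp
    | succ k ih =>
      rw [iterate_succ_apply', hσ, hqσ, ← hσ, ih, add_assoc]
      congr 1
      ext
      simp [Fin.val_add]
  refine ⟨?_, ?_⟩
  · rw [Equiv.Perm.minimalPeriod_eq_card, Fintype.card_fin]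
    intro y
    refine ⟨(q y - q x : Fin (2 * n)), q.injective ?_⟩
    rw [hiter]
    simp
  · rw [Cycle.coe_eq_coe, ← List.mem_cyclicPermutations_iff, cyclicPermutations_ofFn,
      List.mem_ofFn]
    refine ⟨q x, ?_⟩
    unfold rotationRow orbitWord
    congr 1
    funext k
    rw [hF, hiter, add_comm]
    simp

theorem isAlphabetPermutation_two_iff {b : List (Fin 2)} :
    IsAlphabetPermutation b ↔ b = [0, 1] ∨ b = [1, 0] := by
  rw [← List.perm_pair, List.perm_iff_count]
  refine forall_congr' fun c => ?_
  fin_cases c <;> simp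

theorem blockLetter_block {n : ℕ} (s : ZMod n → Bool) (i : ℕ) (h : 2 * i + 1 < 2 * n) :
    [blockLetter s ⟨2 * i, by omega⟩, blockLetter s ⟨2 * i + 1, h⟩] =
      if s i then [1, 0] else [0, 1] := by
  have h1 : (2 * i + 1) / 2 = i := by omega
  unfold blockLetter
  cases hs : s i <;> simp [hs, h1, Nat.add_mod]

theorem ofFn_blockLetter {n : ℕ} (s : ZMod n → Bool) :
    List.ofFn (blockLetter s) =
      (List.ofFn fun i : Fin n => if s (i : ℕ) then [1, 0] else [0, 1]).flatten := by
  rw [List.ofFn_mul']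
  congr 2
  funext i
  have := blockLetter_block s i (by omega)
  simpa [List.ofFn_succ] using this

theorem isAlphabetPermutationPower_ofFn_blockLetter {n : ℕ} [NeZero n] (s : ZMod n → Bool) :
    IsAlphabetPermutationPower (List.ofFn (blockLetter s)) := by
  refine ⟨_, ?_, ?_, ofFn_blockLetter s⟩
  · simp [List.ofFn_eq_nil_iff, NeZero.ne n]
  · intro b hb
    rw [List.mem_ofFn] at hb
    obtain ⟨i, rfl⟩ := hb
    rw [isAlphabetPermutation_two_iff]
    split_ifs <;> simp

theorem exists_eq_ofFn_blockLetter {n : ℕ} [NeZero n] {w : List (Fin 2)} (hlen : w.length = 2 * n)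
    (hw : IsAlphabetPermutationPower w) : ∃ s : ZMod n → Bool, w = List.ofFn (blockLetter s) := by
  obtain ⟨blocks, -, hb, rfl⟩ := hw
  have hb' : ∀ b ∈ blocks, b = [0, 1] ∨ b = [1, 0] := fun b h =>
    isAlphabetPermutation_two_iff.1 (hb b h)
  have hlen2 : blocks.length = n := by
    have : (blocks.map List.length) = blocks.map fun _ => 2 :=
      List.map_congr_left fun b h => by rcases hb' b h with rfl | rfl <;> rfl
    rw [List.length_flatten, this] at hlen
    simp at hlen
    omega
  refine ⟨fun z => decide (blocks[z.val]? = some [1, 0]), ?_⟩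
  rw [ofFn_blockLetter]
  congr 1
  refine List.ext_getElem (by simp [hlen2]) fun i h1 h2 => ?_
  have hi : i < n := hlen2 ▸ h1
  rw [List.getElem_ofFn]
  simp only [ZMod.val_natCast, Nat.mod_eq_of_lt hi, List.getElem?_eq_getElem h1, Option.some.injEq,
    decide_eq_true_eq]
  rcases hb' _ (List.getElem_mem h1) with h | h <;> simp [h]

theorem blockLetter_injective {n : ℕ} [NeZero n] {s s' : ZMod n → Bool}
    (h : blockLetter s = blockLetter s') : s = s' := by
  funext z
  have hz := z.val_lt
  have h1 := blockLetter_block s z.val (by omega)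
  have h2 := blockLetter_block s' z.val (by omega)
  rw [h, h2] at h1
  rw [ZMod.natCast_zmod_val] at h1
  revert h1
  cases s z <;> cases s' z <;> simp

theorem card_generalizedDeBruijnWords {n : ℕ} [NeZero n] (x : Fin (2 * n)) :
    Nat.card (generalizedDeBruijnWords 2 n) =
      Nat.card {s : ZMod n → Bool // minimalPeriod (blockPerm s) x = 2 * n} := by
  symm
  refine Nat.card_eq_of_bijective
    (fun s => ⟨(List.ofFn (orbitWord s.1 x) : Necklace 2), ?_, ?_⟩) ⟨?_, ?_⟩
  · rw [Cycle.length_coe, List.length_ofFn]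
  · rw [bwt_orbitWord s.1 x s.2]
    exact isAlphabetPermutationPower_ofFn_blockLetter s.1
  · rintro ⟨s, hs⟩ ⟨s', hs'⟩ h
    have h1 : (List.ofFn (orbitWord s x) : Necklace 2) = List.ofFn (orbitWord s' x) :=
      congrArg Subtype.val h
    have h2 := congrArg bwt h1
    rw [bwt_orbitWord s x hs, bwt_orbitWord s' x hs'] at h2
    exact Subtype.ext (blockLetter_injective (List.ofFn_injective h2))
  · rintro ⟨c, hlen, hc⟩
    induction c using Quotient.inductionOn' with
    | h l =>
      have hl : l.length = 2 * n := hlen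
      obtain ⟨a, rfl⟩ : ∃ a : Fin (2 * n) → Fin 2, l = List.ofFn a :=
        ⟨fun i => l.get (i.cast hl.symm), by
          refine List.ext_getElem (by simp [hl]) fun i h1 h2 => by simp⟩
      have hc : IsAlphabetPermutationPower (bwt (List.ofFn a : Necklace 2)) := hc
      have hbl : (bwt (List.ofFn a : Necklace 2)).length = 2 * n := by
        rw [bwt_ofFn a _ (Tuple.monotone_sort (rotationRow a)), List.length_ofFn]
      obtain ⟨s, hs⟩ := exists_eq_ofFn_blockLetter hbl hc
      obtain ⟨h1, h2⟩ := exists_orbitWord_of_bwt s x a hs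
      exact ⟨⟨s, h1⟩, Subtype.ext h2⟩

end CircularWord

/-! ### Invertible necklaces as orbits of shifts -/

open Matrix in
theorem Matrix.det_ne_zero_iff_submatrix {m n K : Type*} [Fintype m] [DecidableEq m] [Fintype n]
    [DecidableEq n] [Field K] (A : Matrix m m K) (e₁ e₂ : n ≃ m) :
    (A.submatrix e₁ e₂).det ≠ 0 ↔ A.det ≠ 0 := by
  rw [← isUnit_iff_ne_zero, ← isUnit_iff_ne_zero, ← isUnit_iff_isUnit_det,
    ← isUnit_iff_isUnit_det, isUnit_submatrix_equiv]

namespace CircularWord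

open Matrix

theorem card_eq_mul_of_orbits {α β ι : Type*} (f : α → β) (hf : Function.Surjective f)
    (act : ι → α → α) (hinj : ∀ x, Function.Injective fun k => act k x)
    (h : ∀ x y, f x = f y ↔ ∃ k, act k x = y) : Nat.card α = Nat.card ι * Nat.card β := by
  rw [← Nat.card_prod]
  symm
  refine Nat.card_eq_of_bijective
    (fun p : ι × β => act p.1 (Function.surjInv hf p.2)) ⟨?_, fun y => ?_⟩
  · rintro ⟨k, b⟩ ⟨k', b'⟩ hkb
    have h1 : ∀ k b, f (act k (Function.surjInv hf b)) = b := fun k b => by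
      rw [← (h _ _).2 ⟨k, rfl⟩, Function.surjInv_eq hf]
    have h2 : b = b' := by
      rw [← h1 k b, ← h1 k' b']
      exact congrArg f hkb
    subst h2
    exact Prod.ext (hinj _ hkb) rfl
  · obtain ⟨k, hk⟩ := (h (Function.surjInv hf (f y)) y).1 (Function.surjInv_eq hf _)
    exact ⟨(k, f y), hk⟩

/-- The functions whose circulant matrix is invertible. -/
abbrev InvertibleCirculant (n : ℕ) [NeZero n] : Type :=
  {w : ZMod n → ZMod 2 // (circulant w).det ≠ 0}

/-- Shifting the argument of a function whose circulant matrix is invertible. -/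
def InvertibleCirculant.shift {n : ℕ} [NeZero n] (k : ZMod n) (w : InvertibleCirculant n) :
    InvertibleCirculant n :=
  ⟨fun i => w.1 (i + k), by
    have h : circulant (fun i => w.1 (i + k)) =
        (circulant w.1).submatrix (Equiv.addRight k) (Equiv.refl _) := by
      ext i j
      simp [add_sub_right_comm]
    rw [h, Matrix.det_ne_zero_iff_submatrix]
    exact w.2⟩

/-- Two equal shifts would give two equal rows of the circulant matrix. -/
theorem InvertibleCirculant.shift_injective {n : ℕ} [NeZero n] (w : InvertibleCirculant n) :
    Function.Injective fun k => shift k w := by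
  intro k k' h
  by_contra hk
  refine w.2 (det_zero_of_row_eq hk ?_)
  funext j
  have := congrFun (congrArg Subtype.val h) (-j)
  simpa [shift, sub_eq_add_neg, add_comm] using this

/-- The word over `Fin 2` given by a function on `ZMod n`. -/
def wordOf {n : ℕ} [NeZero n] (w : ZMod n → ZMod 2) (i : Fin n) : Fin 2 := w (ZMod.finEquiv n i)

/-- Sorting only permutes the rows of the matrix with entries `w (i + j)`, and negating the column
index turns that matrix into a circulant. -/
theorem isInvertible_wordOf_iff {n : ℕ} [NeZero n] (w : ZMod n → ZMod 2) :
    IsInvertible (List.ofFn (wordOf w) : Necklace 2) ↔ (circulant w).det ≠ 0 := by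
  have hlen : (List.ofFn (wordOf w) : Necklace 2).length = n := by
    rw [Cycle.length_coe, List.length_ofFn]
  let q : Equiv.Perm (Fin n) := Tuple.sort (rotationRow (wordOf w))
  have hq : Monotone (rotationRow (wordOf w) ∘ q) := Tuple.monotone_sort _
  let e₁ : Fin (List.ofFn (wordOf w) : Necklace 2).length ≃ ZMod n :=
    ((finCongr hlen).trans q).trans (ZMod.finEquiv n).toEquiv
  let e₂ : Fin (List.ofFn (wordOf w) : Necklace 2).length ≃ ZMod n :=
    ((finCongr hlen).trans (ZMod.finEquiv n).toEquiv).trans (Equiv.neg _)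
  have hentry : ∀ i j, bwtMatrix (List.ofFn (wordOf w) : Necklace 2) i j =
      wordOf w (finCongr hlen j + q (finCongr hlen i)) := by
    intro i j
    simp only [bwtMatrix, of_apply, bwtRows_ofFn _ q hq, List.getElem_ofFn,
      Function.comp_apply, rotationRow]
    rfl
  have h : (bwtMatrix (List.ofFn (wordOf w) : Necklace 2)).map (fun a : Fin 2 => (a.val : ZMod 2)) =
      (circulant w).submatrix e₁ e₂ := by
    ext i j
    have hcast : ∀ x : ZMod 2, ((x : Fin 2).val : ZMod 2) = x := by decide
    rw [map_apply, hentry]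
    refine (hcast _).trans (congrArg w ?_)
    rw [map_add, add_comm]
    exact (sub_neg_eq_add _ _).symm
  rw [IsInvertible, h, Matrix.det_ne_zero_iff_submatrix]

theorem coe_ofFn_wordOf_eq_iff {n : ℕ} [NeZero n] (w w' : ZMod n → ZMod 2) :
    (List.ofFn (wordOf w) : Necklace 2) = List.ofFn (wordOf w') ↔
      ∃ k : ZMod n, (fun i => w (i + k)) = w' := by
  rw [Cycle.coe_eq_coe, List.isRotated_comm, ← List.mem_cyclicPermutations_iff,
    cyclicPermutations_ofFn, List.mem_ofFn]
  refine Iff.trans (exists_congr fun k => ?_) (ZMod.finEquiv n).surjective.exists.symm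
  rw [rotationRow, List.ofFn_inj, funext_iff, funext_iff]
  refine Iff.trans ?_ (ZMod.finEquiv n).surjective.forall.symm
  simp only [wordOf, map_add]
  rfl

theorem card_invertibleNecklaces (n : ℕ) [NeZero n] :
    Nat.card (InvertibleCirculant n) = n * Nat.card (invertibleNecklaces 2 n) := by
  have := card_eq_mul_of_orbits (ι := ZMod n)
    (fun w : InvertibleCirculant n => (⟨(List.ofFn (wordOf w.1) : Necklace 2), by
      rw [Cycle.length_coe, List.length_ofFn], (isInvertible_wordOf_iff w.1).2 w.2⟩ :
        invertibleNecklaces 2 n)) ?_ InvertibleCirculant.shift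
    InvertibleCirculant.shift_injective ?_
  · rwa [Nat.card_zmod] at this
  · rintro ⟨c, hlen, hc⟩
    induction c using Quotient.inductionOn' with
    | h l =>
      have hl : l.length = n := hlen
      obtain ⟨w, rfl⟩ : ∃ w : ZMod n → ZMod 2, l = List.ofFn (wordOf w) :=
        ⟨fun i => l.get (((ZMod.finEquiv n).symm i).cast hl.symm), by
          refine List.ext_getElem (by simp [hl]) fun i h1 h2 => by simp [wordOf]⟩
      exact ⟨⟨w, (isInvertible_wordOf_iff w).1 hc⟩, rfl⟩
  · intro w w'
    exact Subtype.ext_iff.trans ((coe_ofFn_wordOf_eq_iff w.1 w'.1).trans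
      (exists_congr fun k => ⟨fun h => Subtype.ext h, congrArg Subtype.val⟩))

end CircularWord

/-! ### Normal bases as orbits of shifts -/

namespace CircularWord

open Matrix

/-- This is the normal basis theorem, with automorphisms written as Frobenius powers; Frobenius has
order `n`. -/
theorem exists_basis_pow_two_pow (n : ℕ) [NeZero n] :
    ∃ (θ : GaloisField 2 n) (b : Module.Basis (ZMod n) (ZMod 2) (GaloisField 2 n)),
      ∀ i, b i = θ ^ 2 ^ i.val := by
  have hn := NeZero.ne n
  obtain ⟨θ, hθ⟩ := exists_linearIndependent_algEquiv_apply (ZMod 2) (GaloisField 2 n)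
  have hfin : Module.finrank (ZMod 2) (GaloisField 2 n) = n := GaloisField.finrank 2 hn
  let φ := FiniteField.frobeniusAlgEquivOfAlgebraic (ZMod 2) (GaloisField 2 n)
  have hinj : Function.Injective fun i : ZMod n => φ ^ i.val := by
    intro i j hij
    have hord : orderOf φ = n := by
      rw [FiniteField.orderOf_frobeniusAlgEquivOfAlgebraic, hfin]
    exact ZMod.val_injective n (pow_injOn_Iio_orderOf
      (by rw [hord]; exact i.val_lt) (by rw [hord]; exact j.val_lt) hij)
  have hli := hθ.comp _ hinj
  have hφ : ∀ k : ℕ, (φ ^ k) θ = θ ^ 2 ^ k := by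
    intro k
    rw [AlgEquiv.coe_pow, FiniteField.coe_frobeniusAlgEquivOfAlgebraic_iterate, ZMod.card]
  refine ⟨θ, basisOfLinearIndependentOfCardEqFinrank hli (by rw [ZMod.card, hfin]), fun i => ?_⟩
  rw [coe_basisOfLinearIndependentOfCardEqFinrank]
  exact hφ i.val

theorem pow_two_pow_eq_of_mod {n : ℕ} [NeZero n] (x : GaloisField 2 n) {k l : ℕ}
    (h : (k : ZMod n) = l) : x ^ 2 ^ k = x ^ 2 ^ l := by
  have hx : x ^ 2 ^ n = x := by
    have := Fintype.ofFinite (GaloisField 2 n)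
    rw [← GaloisField.card 2 n (NeZero.ne n), Nat.card_eq_fintype_card, FiniteField.pow_card]
  have key : ∀ k m : ℕ, x ^ 2 ^ (k + n * m) = x ^ 2 ^ k := by
    intro k m
    induction m with
    | zero => simp
    | succ m ih => rw [Nat.mul_succ, ← add_assoc, add_comm _ n, pow_add, pow_mul, hx, ih]
  have hmod : ∀ k : ℕ, x ^ 2 ^ k = x ^ 2 ^ (k % n) := fun k => by
    conv_lhs => rw [← Nat.mod_add_div k n, key]
  rw [hmod k, hmod l, (ZMod.natCast_eq_natCast_iff' _ _ _).1 h]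

/-- Frobenius fixes the coefficients and permutes the basis cyclically, so it shifts coordinates. -/
theorem basis_sum_pow {n : ℕ} [NeZero n] {θ : GaloisField 2 n}
    {b : Module.Basis (ZMod n) (ZMod 2) (GaloisField 2 n)} (hb : ∀ i, b i = θ ^ 2 ^ i.val)
    (w : ZMod n → ZMod 2) (k : ℕ) :
    (b.equivFun.symm w) ^ 2 ^ k = b.equivFun.symm fun i => w (i - k) := by
  rw [Module.Basis.equivFun_symm_apply, Module.Basis.equivFun_symm_apply, sum_pow_char_pow,
    ← (Equiv.subRight (k : ZMod n)).sum_comp]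
  refine Finset.sum_congr rfl fun i _ => ?_
  rw [Equiv.subRight_apply, smul_pow, ZMod.pow_card_pow, hb, hb, ← pow_mul, ← pow_add]
  congr 1
  refine pow_two_pow_eq_of_mod θ ?_
  simp

theorem isNormalElement_iff {n : ℕ} [NeZero n] {θ : GaloisField 2 n}
    {b : Module.Basis (ZMod n) (ZMod 2) (GaloisField 2 n)} (hb : ∀ i, b i = θ ^ 2 ^ i.val)
    (w : ZMod n → ZMod 2) :
    IsNormalElement 2 n (b.equivFun.symm w) ↔ (circulant w).det ≠ 0 := by
  have h1 : (fun i : Fin n => (b.equivFun.symm w) ^ 2 ^ i.val) =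
      b.equivFun.symm ∘ ((circulant w)ᵀ.row ∘ ZMod.finEquiv n) := by
    funext i
    rw [basis_sum_pow hb]
    congr 1
    funext j
    simp [ZMod.finEquiv_apply]
  have h2 : LinearIndependent (ZMod 2) (fun i : Fin n => (b.equivFun.symm w) ^ 2 ^ i.val) ↔
      (circulant w).det ≠ 0 := by
    rw [h1, ← isUnit_iff_ne_zero, ← det_transpose, ← isUnit_iff_isUnit_det,
      ← linearIndependent_rows_iff_isUnit]
    rw [← linearIndependent_equiv (ZMod.finEquiv n).toEquiv]
    exact b.equivFun.symm.toLinearMap.linearIndependent_iff (LinearEquiv.ker _)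
  rw [IsNormalElement, h2, and_iff_left_iff_imp]
  intro h
  refine (h2.2 h).span_eq_top_of_card_eq_finrank' ?_
  rw [GaloisField.finrank 2 (NeZero.ne n), Fintype.card_fin]

theorem card_normalBases (n : ℕ) [NeZero n] :
    Nat.card (InvertibleCirculant n) = n * Nat.card (normalBases 2 n) := by
  obtain ⟨θ, b, hb⟩ := exists_basis_pow_two_pow n
  have hrange : ∀ w : ZMod n → ZMod 2,
      (Set.range fun i : Fin n => (b.equivFun.symm w) ^ 2 ^ i.val) =
        Set.range fun k : ZMod n => b.equivFun.symm fun i => w (i + k) := by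
    intro w
    rw [← ((ZMod.finEquiv n).toEquiv.trans (Equiv.neg _)).surjective.range_comp]
    congr 1
    funext i
    rw [basis_sum_pow hb]
    simp [ZMod.finEquiv_apply, sub_eq_add_neg]
  have := card_eq_mul_of_orbits (ι := ZMod n)
    (fun w : InvertibleCirculant n => (⟨Set.range fun i : Fin n => (b.equivFun.symm w.1) ^ 2 ^ i.val,
      _, (isNormalElement_iff hb w.1).2 w.2, rfl⟩ : normalBases 2 n)) ?_ InvertibleCirculant.shift
    InvertibleCirculant.shift_injective ?_
  · rwa [Nat.card_zmod] at this
  · rintro ⟨_, γ, hγ, rfl⟩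
    obtain ⟨w, rfl⟩ := b.equivFun.symm.surjective γ
    exact ⟨⟨w, (isNormalElement_iff hb w).1 hγ⟩, rfl⟩
  · intro w w'
    refine Subtype.ext_iff.trans ?_
    change (Set.range fun i : Fin n => (b.equivFun.symm w.1) ^ 2 ^ i.val) =
      (Set.range fun i : Fin n => (b.equivFun.symm w'.1) ^ 2 ^ i.val) ↔ _
    rw [hrange, hrange]
    constructor
    · intro h
      -- A normal basis contains its generator, so two generators of one basis are conjugate.
      have h1 : b.equivFun.symm w'.1 ∈
          Set.range fun k : ZMod n => b.equivFun.symm fun i => w.1 (i + k) := by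
        rw [h]
        exact ⟨0, by simp⟩
      obtain ⟨k, hk⟩ := h1
      exact ⟨k, Subtype.ext (b.equivFun.symm.injective hk)⟩
    · rintro ⟨k, rfl⟩
      rw [← (Equiv.addRight k).surjective.range_comp]
      congr 1
      funext j
      refine congrArg b.equivFun.symm (funext fun i => congrArg w.1 ?_)
      change i + (j + k) = i + j + k
      rw [add_assoc]

end CircularWord

/-! ### Comparison of the three counts -/

namespace CircularWord

theorem card_generalizedDeBruijnWords_mul (n : ℕ) [NeZero n] :
    Nat.card (InvertibleCirculant n) = n * Nat.card (generalizedDeBruijnWords 2 n) := by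
  have h1 := card_blockPerm_cycle (n := n)
  have hdet : (2 • 1 - doublingMatrix n ℚ).det = ((2 • 1 - doublingMatrix n ℤ).det : ℚ) := by
    refine Eq.trans ?_ (RingHom.map_det (Int.castRingHom ℚ) _).symm
    rw [map_sub, map_nsmul, map_one]
    congr 2
    ext i j
    simp [doublingMatrix]
  rw [card_det_circulant_ne_zero, card_generalizedDeBruijnWords (edgeEquiv n (.inl 0)),
    Nat.card_eq_fintype_card]
  rw [hdet] at h1
  -- The integer determinant equals `n` times a cardinality; being nonnegative, it agrees with its
  -- absolute value.
  have h2 : ((n * Fintype.card {s : ZMod n → Bool //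
      Function.minimalPeriod (blockPerm s) (edgeEquiv n (.inl 0)) = 2 * n} : ℕ) : ℤ) =
      (2 • 1 - doublingMatrix n ℤ).det := by exact_mod_cast h1
  rw [← h2, Int.natAbs_natCast]

theorem finite_of_length {k : ℕ} (m : ℕ) : {c : Necklace k | c.length = m}.Finite := by
  refine Finite.of_surjective (fun a : Fin m → Fin k =>
    (⟨(List.ofFn a : Necklace k), by rw [Cycle.length_coe, List.length_ofFn]⟩ :
      {c : Necklace k // c.length = m})) ?_
  rintro ⟨c, hc⟩
  induction c using Quotient.inductionOn' with
  | h l =>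
    have hl : l.length = m := hc
    subst hl
    exact ⟨l.get, Subtype.ext (congrArg ((↑) : List (Fin k) → Necklace k) (List.ofFn_get l))⟩

end CircularWord

theorem mainTheorem7 (n : ℕ) (hn : 1 ≤ n) :
    Nonempty (CircularWord.generalizedDeBruijnWords 2 n ≃ CircularWord.invertibleNecklaces 2 n) ∧
      Nonempty (CircularWord.invertibleNecklaces 2 n ≃ CircularWord.normalBases 2 n) := by
  have : NeZero n := ⟨by omega⟩
  have h1 := CircularWord.card_generalizedDeBruijnWords_mul n
  have h2 := CircularWord.card_invertibleNecklaces n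
  have h3 := CircularWord.card_normalBases n
  -- `Nat.card` is `0` on infinite types, so equal values give bijections only once finiteness is
  -- known.
  have : Finite (CircularWord.generalizedDeBruijnWords 2 n) :=
    ((CircularWord.finite_of_length (2 * n)).subset fun _ h => h.1).to_subtype
  have : Finite (CircularWord.invertibleNecklaces 2 n) :=
    ((CircularWord.finite_of_length n).subset fun _ h => h.1).to_subtype
  rw [h2] at h1 h3
  exact ⟨Finite.card_eq.1 (Nat.eq_of_mul_eq_mul_left hn h1).symm,
    Finite.card_eq.1 (Nat.eq_of_mul_eq_mul_left hn h3)⟩
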